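/- Let $K$ denote prefix-free Kolmogorov complexity of finite strings over $\{-1,1\}$ (with respect to a fixed universal prefix-free machine). An infinite string $\alpha=\alpha_0\alpha_1\alpha_2\dots\in\{-1,1\}^{\mathbb N}$ is called Kolmogorov–Chaitin complex if there is $k\in\mathbb N$ such that $K(\alpha_0\cdots\alpha_{n-1})\ge n-k$ for all $n\in\mathbb N$. A sequence $(\varepsilon_n)_{n\ge 0}$ is called an algorithmically random Rademacher sequence if there is a Kolmogorov–Chaitin complex $\alpha$ with $\varepsilon_n=\alpha_n$ for all $n\ge 0$. A sequence $(x_n)_{n\ge0}$ of real numbers is called computable if there is a computable double sequence of rationals $(r_{n,m})$ with $|x_n-r_{n,m}|\le 2^{-m}$ for all $n,m\ge 0$. Let $(x_n)_{n\ge 0}$ and $(\phi_n)_{n\ge 0}$ be computable sequences of real numbers, and let $(\varepsilon_n)_{n\ge 0}$ be an algorithmically random Rademacher sequence. Put $$s_j=\Bigl(\sum_{2^j\le n<2^{j+1}}x_n^2\Bigr)^{1/2},\qquad j=0,1,2,\dots,$$ and suppose that $(s_j)_{j\ge 0}$ is decreasing (in the weak sense, $s_{j+1}\le s_j$) and that $\sum_{j}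 s_j<\infty$. Then the series $$\sum_{n=0}^{\infty}\varepsilon_n x_n\cos(2\pi n t+\phi_n)$$ converges uniformly in $t\in\mathbb R$ (equivalently, by periodicity, in $t\in[0,1]$) to a continuous function; that is, its partial sums $\sum_{n<N}$ converge uniformly as $N\to\infty$. -/

import Mathlib

open Filter Topology

/-! Prefix-free Kolmogorov complexity. The bits `-1`, `1` are coded as `false`, `true`. -/

/-- A prefix-free machine: a partial recursive function on finite binary strings such that no
string of its domain is a proper prefix of another one. -/
structure IsPrefixFreeMachine (M : List Bool →. List Bool) : Prop where
  partrec : Partrec M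
  prefix_free : ∀ p q : List Bool, (M p).Dom → (M q).Dom → p <+: q → p = q

/-- The complexity of a string `σ` with respect to the machine `M`: the length of a shortest
program `p` with `M p = σ` (and `⊤` if there is none). -/
noncomputable def machineComplexity (M : List Bool →. List Bool) (σ : List Bool) : ℕ∞ :=
  ⨅ p : List Bool, ⨅ _ : σ ∈ M p, (p.length : ℕ∞)

/-- The program coded by the number `t.unpair.1` is different from `p`, comparable with `p`, and
the code `c` halts on it within `t.unpair.2` steps. -/
def conflictAt (c : Nat.Partrec.Code) (p : List Bool) (t : ℕ) : Bool :=
  ((Encodable.decode (α := List Bool) t.unpair.1).map fun q =>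
    (!decide (q = p) && (decide (p.take q.length = q) || decide (q.take p.length = p)))).getD
      false &&
  (Nat.Partrec.Code.evaln t.unpair.2 c t.unpair.1).isSome

/-- The computation of the code `c` on the program `p` within `k` steps, where the result is
discarded if a comparable program has been seen to halt earlier (in the order of the numbers
coding pairs of a program and a number of steps). -/
def prefixFreeStep (c : Nat.Partrec.Code) (p : List Bool) (k : ℕ) : Option (List Bool) :=
  bif (List.range (Nat.pair (Encodable.encode p) k)).foldr (fun t b => conflictAt c p t || b) false
  then none
  else (Nat.Partrec.Code.evaln k c (Encodable.encode p)).bind Encodable.decode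

/-- The universal prefix-free machine: on the input `0ᵉ1p` it simulates the `e`-th partial
recursive function, made prefix-free, on the program `p`. -/
def universalMachine (l : List Bool) : Part (List Bool) :=
  Nat.rfindOpt fun k =>
    bif l.contains true then
      prefixFreeStep (Denumerable.ofNat Nat.Partrec.Code (l.idxOf true))
        (l.drop (l.idxOf true + 1)) k
    else none

/-- The (prefix-free) Kolmogorov complexity of a finite string. -/
noncomputable def kolmogorovComplexity (σ : List Bool) : ℕ∞ :=
  machineComplexity universalMachine σ

theorem foldr_or_eq_true {f : ℕ → Bool} (L : List ℕ) :
    L.foldr (fun t b => f t || b) false = true ↔ ∃ t ∈ L, f t = true := by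
  induction L with
  | nil => simp
  | cons a L ih => simp [ih]

theorem primrec_conflictAt :
    Primrec fun a : (Nat.Partrec.Code × List Bool) × ℕ => conflictAt a.1.1 a.1.2 a.2 := by
  unfold conflictAt
  have hu : Primrec fun a : (Nat.Partrec.Code × List Bool) × ℕ => a.2.unpair :=
    Primrec.unpair.comp Primrec.snd
  have h1 : Primrec fun a : (Nat.Partrec.Code × List Bool) × ℕ =>
      Encodable.decode (α := List Bool) a.2.unpair.1 :=
    Primrec.decode.comp (Primrec.fst.comp hu)
  have hq : Primrec fun b : ((Nat.Partrec.Code × List Bool) × ℕ) × List Bool => b.2 := Primrec.snd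
  have hp : Primrec fun b : ((Nat.Partrec.Code × List Bool) × ℕ) × List Bool => b.1.1.2 :=
    Primrec.snd.comp (Primrec.fst.comp Primrec.fst)
  have hg : Primrec fun b : ((Nat.Partrec.Code × List Bool) × ℕ) × List Bool =>
      (!decide (b.2 = b.1.1.2) && (decide (b.1.1.2.take b.2.length = b.2) ||
        decide (b.2.take b.1.1.2.length = b.1.1.2))) := by
    have heq := PrimrecRel.decide (Primrec.eq (α := List Bool))
    refine Primrec.and.comp (Primrec.not.comp (heq.comp hq hp)) (Primrec.or.comp ?_ ?_)
    · exact heq.comp (Primrec.list_take.comp (Primrec.list_length.comp hq) hp) hq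
    · exact heq.comp (Primrec.list_take.comp (Primrec.list_length.comp hp) hq) hp
  refine Primrec.and.comp (Primrec.option_getD.comp (Primrec.option_map h1 hg.to₂)
    (Primrec.const false)) (Primrec.option_isSome.comp ?_)
  exact Nat.Partrec.Code.primrec_evaln.comp
    (((Primrec.snd.comp hu).pair (Primrec.fst.comp Primrec.fst)).pair (Primrec.fst.comp hu))

theorem primrec_prefixFreeStep :
    Primrec fun a : (Nat.Partrec.Code × List Bool) × ℕ => prefixFreeStep a.1.1 a.1.2 a.2 := by
  unfold prefixFreeStep
  have he : Primrec fun a : (Nat.Partrec.Code × List Bool) × ℕ => Encodable.encode a.1.2 :=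
    Primrec.encode.comp (Primrec.snd.comp Primrec.fst)
  have hr : Primrec fun a : (Nat.Partrec.Code × List Bool) × ℕ =>
      List.range (Nat.pair (Encodable.encode a.1.2) a.2) :=
    Primrec.list_range.comp (Primrec₂.natPair.comp he Primrec.snd)
  have hh : Primrec₂ fun (a : (Nat.Partrec.Code × List Bool) × ℕ) (tb : ℕ × Bool) =>
      (conflictAt a.1.1 a.1.2 tb.1 || tb.2) := by
    have h1 : Primrec fun u : ((Nat.Partrec.Code × List Bool) × ℕ) × (ℕ × Bool) =>
        ((u.1.1, u.2.1) : (Nat.Partrec.Code × List Bool) × ℕ) :=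
      (Primrec.fst.comp Primrec.fst).pair (Primrec.fst.comp Primrec.snd)
    have h2 : Primrec fun u : ((Nat.Partrec.Code × List Bool) × ℕ) × (ℕ × Bool) =>
        conflictAt u.1.1.1 u.1.1.2 u.2.1 := primrec_conflictAt.comp h1
    exact Primrec.or.comp h2 (Primrec.snd.comp Primrec.snd)
  have hf : Primrec fun a : (Nat.Partrec.Code × List Bool) × ℕ =>
      (List.range (Nat.pair (Encodable.encode a.1.2) a.2)).foldr
        (fun t b => conflictAt a.1.1 a.1.2 t || b) false :=
    Primrec.list_foldr hr (Primrec.const false) hh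
  have ha : Primrec fun a : (Nat.Partrec.Code × List Bool) × ℕ =>
      ((a.2, a.1.1), Encodable.encode a.1.2) :=
    (Primrec.snd.pair (Primrec.fst.comp Primrec.fst)).pair he
  have hev : Primrec fun a : (Nat.Partrec.Code × List Bool) × ℕ =>
      Nat.Partrec.Code.evaln a.2 a.1.1 (Encodable.encode a.1.2) :=
    Nat.Partrec.Code.primrec_evaln.comp ha
  have hd : Primrec₂ fun (_ : (Nat.Partrec.Code × List Bool) × ℕ) (n : ℕ) =>
      (Encodable.decode n : Option (List Bool)) := (Primrec.decode.comp Primrec.snd).to₂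
  exact Primrec.cond hf (Primrec.const none) (Primrec.option_bind hev hd)

theorem partrec_universalMachine : Partrec universalMachine := by
  have hi : Primrec fun a : List Bool × ℕ => a.1.idxOf true :=
    Primrec.list_idxOf.comp (Primrec.const true) Primrec.fst
  have hb : Primrec fun a : List Bool × ℕ => a.1.contains true := by
    refine ((PrimrecRel.decide Primrec.nat_lt).comp hi
      (Primrec.list_length.comp Primrec.fst)).of_eq fun a => ?_
    rw [Bool.eq_iff_iff]
    simpa using List.idxOf_lt_length_iff
  have hc : Primrec fun a : List Bool × ℕ =>
      Denumerable.ofNat Nat.Partrec.Code (a.1.idxOf true) :=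
    (Primrec.ofNat Nat.Partrec.Code).comp hi
  have hd : Primrec fun a : List Bool × ℕ => a.1.drop (a.1.idxOf true + 1) :=
    Primrec.list_drop.comp (Primrec.succ.comp hi) Primrec.fst
  have hs : Primrec fun a : List Bool × ℕ =>
      prefixFreeStep (Denumerable.ofNat Nat.Partrec.Code (a.1.idxOf true))
        (a.1.drop (a.1.idxOf true + 1)) a.2 :=
    Primrec.comp
      (f := fun a : (Nat.Partrec.Code × List Bool) × ℕ => prefixFreeStep a.1.1 a.1.2 a.2)
      (g := fun a : List Bool × ℕ => ((Denumerable.ofNat Nat.Partrec.Code (a.1.idxOf true),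
        a.1.drop (a.1.idxOf true + 1)), a.2))
      primrec_prefixFreeStep ((hc.pair hd).pair Primrec.snd)
  have h : Primrec fun a : List Bool × ℕ =>
      bif a.1.contains true then
        prefixFreeStep (Denumerable.ofNat Nat.Partrec.Code (a.1.idxOf true))
          (a.1.drop (a.1.idxOf true + 1)) a.2
      else none := Primrec.cond hb hs (Primrec.const none)
  exact Partrec.rfindOpt h.to_comp.to₂

theorem conflictAt_eq_true {c : Nat.Partrec.Code} {p : List Bool} {t : ℕ} :
    conflictAt c p t = true ↔ ∃ q : List Bool, Encodable.decode t.unpair.1 = some q ∧ q ≠ p ∧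
      (q <+: p ∨ p <+: q) ∧ (Nat.Partrec.Code.evaln t.unpair.2 c t.unpair.1).isSome := by
  unfold conflictAt
  rcases h : Encodable.decode (α := List Bool) t.unpair.1 with _ | q
  · simp
  · have h1 : q <+: p ↔ p.take q.length = q := by rw [List.prefix_iff_eq_take, eq_comm]
    have h2 : p <+: q ↔ q.take p.length = p := by rw [List.prefix_iff_eq_take, eq_comm]
    simp only [Option.map_some, Option.getD_some, Bool.and_eq_true, Bool.or_eq_true,
      Bool.not_eq_true', decide_eq_true_eq, decide_eq_false_iff_not, Option.some.injEq,
      exists_eq_left', h1, h2, and_assoc, ne_eq]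

theorem prefixFreeStep_eq_some {c : Nat.Partrec.Code} {p σ : List Bool} {k : ℕ} :
    prefixFreeStep c p k = some σ ↔
      (∀ t < Nat.pair (Encodable.encode p) k, ¬ conflictAt c p t = true) ∧
      ∃ y ∈ Nat.Partrec.Code.evaln k c (Encodable.encode p), Encodable.decode y = some σ := by
  unfold prefixFreeStep
  rcases h : (List.range (Nat.pair (Encodable.encode p) k)).foldr
    (fun t b => conflictAt c p t || b) false
  · have h' : ¬ ∃ t ∈ List.range (Nat.pair (Encodable.encode p) k), conflictAt c p t = true := by
      rw [← foldr_or_eq_true, h]; simp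
    have h'' : ∀ t < Nat.pair (Encodable.encode p) k, ¬ conflictAt c p t = true := by
      intro t ht hc
      exact h' ⟨t, List.mem_range.2 ht, hc⟩
    simp only [cond_false, Option.bind_eq_some_iff, Option.mem_def]
    exact ⟨fun H => ⟨h'', H⟩, fun H => H.2⟩
  · obtain ⟨t, ht, hc⟩ := (foldr_or_eq_true _).1 h
    simp only [cond_true]
    refine ⟨fun H => by simp at H, fun H => absurd hc (H.1 t (List.mem_range.1 ht))⟩

theorem prefixFreeStep_comparable {c : Nat.Partrec.Code} {p q σ τ : List Bool} {j k : ℕ}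
    (hp : prefixFreeStep c p j = some σ) (hq : prefixFreeStep c q k = some τ)
    (hpq : p <+: q ∨ q <+: p) : p = q := by
  by_contra hne
  obtain ⟨hp1, y, hy, -⟩ := prefixFreeStep_eq_some.1 hp
  obtain ⟨hq1, z, hz, -⟩ := prefixFreeStep_eq_some.1 hq
  rcases lt_trichotomy (Nat.pair (Encodable.encode p) j) (Nat.pair (Encodable.encode q) k)
    with h | h | h
  · refine hq1 _ h (conflictAt_eq_true.2 ⟨p, by simp, hne, hpq, ?_⟩)
    simpa using Option.isSome_iff_exists.2 ⟨y, hy⟩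
  · exact hne (Encodable.encode_injective (Nat.pair_eq_pair.1 h).1)
  · refine hp1 _ h (conflictAt_eq_true.2 ⟨q, by simp, Ne.symm hne, hpq.symm, ?_⟩)
    simpa using Option.isSome_iff_exists.2 ⟨z, hz⟩

theorem idxOf_replicate_append (e : ℕ) (p : List Bool) :
    (List.replicate e false ++ true :: p).idxOf true = e := by
  induction e with
  | zero => simp
  | succ e ih => simp [List.replicate_succ, ih]

theorem eq_replicate_append {l : List Bool} (h : true ∈ l) :
    l = List.replicate (l.idxOf true) false ++ true :: l.drop (l.idxOf true + 1) := by
  induction l with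
  | nil => simp at h
  | cons b l ih =>
    cases b
    · have h' : true ∈ l := by simpa using h
      have := ih h'
      simp only [List.idxOf_cons]
      simpa [List.replicate_succ] using this
    · simp

theorem mem_universalMachine_spec {l σ : List Bool} (h : σ ∈ universalMachine l) :
    true ∈ l ∧ ∃ k, prefixFreeStep (Denumerable.ofNat Nat.Partrec.Code (l.idxOf true))
      (l.drop (l.idxOf true + 1)) k = some σ := by
  obtain ⟨k, hk⟩ := Nat.rfindOpt_spec h
  by_cases ht : true ∈ l
  · refine ⟨ht, k, ?_⟩
    simpa [ht] using hk
  · simp [ht] at hk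

theorem isPrefixFreeMachine_universalMachine : IsPrefixFreeMachine universalMachine := by
  refine ⟨partrec_universalMachine, fun l m hl hm hlm => ?_⟩
  obtain ⟨σ, hσ⟩ := Part.dom_iff_mem.1 hl
  obtain ⟨τ, hτ⟩ := Part.dom_iff_mem.1 hm
  obtain ⟨hl1, j, hj⟩ := mem_universalMachine_spec hσ
  obtain ⟨hm1, k, hk⟩ := mem_universalMachine_spec hτ
  obtain ⟨r, rfl⟩ := hlm
  have hidx : (l ++ r).idxOf true = l.idxOf true := List.idxOf_append_of_mem hl1
  have hlt : l.idxOf true + 1 ≤ l.length := List.idxOf_lt_length_iff.2 hl1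
  rw [hidx, List.drop_append_of_le_length hlt] at hk
  have := prefixFreeStep_comparable hj hk (Or.inl (List.prefix_append _ _))
  have hr : r = [] := by simpa using this
  simp [hr]

/-- The universal machine simulates every prefix-free machine by prepending a fixed word. -/
theorem exists_simulation {M : List Bool →. List Bool} (hM : IsPrefixFreeMachine M) :
    ∃ w : List Bool, ∀ p σ : List Bool, σ ∈ M p → σ ∈ universalMachine (w ++ p) := by
  obtain ⟨c, hc⟩ := Nat.Partrec.Code.exists_code.1 hM.partrec
  refine ⟨List.replicate (Encodable.encode c) false ++ [true], fun p σ hσ => ?_⟩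
  have hev : Encodable.encode σ ∈ Nat.Partrec.Code.eval c (Encodable.encode p) := by
    rw [hc]; simpa using (Part.mem_map Encodable.encode hσ)
  obtain ⟨k, hk⟩ := Nat.Partrec.Code.evaln_complete.1 hev
  have hstep : prefixFreeStep c p k = some σ := by
    refine prefixFreeStep_eq_some.2 ⟨fun t _ hcon => ?_, _, hk, by simp⟩
    obtain ⟨q, hq, hne, hcmp, hs⟩ := conflictAt_eq_true.1 hcon
    obtain ⟨y, hy⟩ := Option.isSome_iff_exists.1 hs
    have hy' := Nat.Partrec.Code.evaln_sound hy
    rw [hc] at hy'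
    have hqdom : (M q).Dom := by
      simp only [hq, Part.coe_some, Part.bind_some, Part.mem_map_iff] at hy'
      obtain ⟨τ, hτ, -⟩ := hy'
      exact Part.dom_iff_mem.2 ⟨τ, hτ⟩
    have hpdom : (M p).Dom := Part.dom_iff_mem.2 ⟨σ, hσ⟩
    rcases hcmp with h | h
    · exact hne (hM.prefix_free _ _ hqdom hpdom h)
    · exact hne (hM.prefix_free _ _ hpdom hqdom h).symm
  have hl : List.replicate (Encodable.encode c) false ++ [true] ++ p =
      List.replicate (Encodable.encode c) false ++ true :: p := by simp
  have hdrop : (List.replicate (Encodable.encode c) false ++ true :: p).drop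
      (Encodable.encode c + 1) = p := by
    rw [← hl, List.drop_left' (by simp)]
  have hdom : (universalMachine (List.replicate (Encodable.encode c) false ++ [true] ++ p)).Dom := by
    refine Nat.rfindOpt_dom.2 ⟨k, σ, ?_⟩
    rw [hl, idxOf_replicate_append, hdrop, Denumerable.ofNat_encode]
    simpa using hstep
  obtain ⟨τ, hτ⟩ := Part.dom_iff_mem.1 hdom
  obtain ⟨-, j, hj⟩ := mem_universalMachine_spec hτ
  rw [hl, idxOf_replicate_append, hdrop, Denumerable.ofNat_encode] at hj
  obtain ⟨-, z, hz, hz2⟩ := prefixFreeStep_eq_some.1 hj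
  have hzz := Part.mem_unique (Nat.Partrec.Code.evaln_sound hz) hev
  rw [hzz, Encodable.encodek] at hz2
  rw [Option.some.inj hz2]
  exact hτ

/-- The invariance theorem: up to a constant, the Kolmogorov complexity is at most the complexity
with respect to any prefix-free machine. -/
theorem kolmogorovComplexity_le {M : List Bool →. List Bool} (hM : IsPrefixFreeMachine M) :
    ∃ d : ℕ, ∀ σ : List Bool, kolmogorovComplexity σ ≤ machineComplexity M σ + d := by
  obtain ⟨w, hw⟩ := exists_simulation hM
  refine ⟨w.length, fun σ => ?_⟩
  by_cases h : ∃ p, σ ∈ M p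
  · have : Nonempty {p // σ ∈ M p} := ⟨⟨h.choose, h.choose_spec⟩⟩
    have hM' : machineComplexity M σ = ⨅ p : {p // σ ∈ M p}, (p.1.length : ℕ∞) := by
      rw [machineComplexity, iInf_subtype']
    have hU : ∀ q, σ ∈ universalMachine q → kolmogorovComplexity σ ≤ (q.length : ℕ∞) :=
      fun q hq => by
        unfold kolmogorovComplexity machineComplexity
        exact iInf₂_le q hq
    rw [hM', ENat.iInf_add]
    refine le_iInf fun p => (hU _ (hw _ _ p.2)).trans (le_of_eq ?_)
    rw [List.length_append, Nat.cast_add, add_comm]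
  · have : machineComplexity M σ = ⊤ := by
      push Not at h
      simp [machineComplexity, h]
    simp [this]

/-- The infinite binary string `α` is Kolmogorov-Chaitin complex:
`K(α₀ … α_{n-1}) ≥ n - k` for some `k` and all `n`. -/
def IsKolmogorovChaitinComplex (α : ℕ → Bool) : Prop :=
  ∃ k : ℕ, ∀ n : ℕ, (n : ℕ∞) ≤ kolmogorovComplexity ((List.range n).map α) + k

/-- An algorithmically random Rademacher sequence: the sequence of the bits `±1` of a
Kolmogorov-Chaitin complex string. -/
def IsAlgorithmicallyRandomRademacher (ε : ℕ → ℝ) : Prop :=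
  ∃ α : ℕ → Bool, IsKolmogorovChaitinComplex α ∧ ∀ n, ε n = if α n then 1 else -1

/-- A computable sequence of real numbers: there is a computable double sequence of rationals
`(a n m - b n m) / (c n m + 1)` that approximates `x n` with error at most `2⁻ᵐ`. -/
def IsComputableRealSeq (x : ℕ → ℝ) : Prop :=
  ∃ a b c : ℕ → ℕ → ℕ, Computable₂ a ∧ Computable₂ b ∧ Computable₂ c ∧
    ∀ n m : ℕ, |x n - ((a n m : ℝ) - (b n m : ℝ)) / ((c n m : ℝ) + 1)| ≤ (1 / 2 : ℝ) ^ m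

/-- The dyadic block norms `s_j = (∑_{2^j ≤ n < 2^(j+1)} x_n²)^{1/2}`. -/
noncomputable def dyadicBlockNorm (x : ℕ → ℝ) (j : ℕ) : ℝ :=
  Real.sqrt (∑ n ∈ Finset.Ico (2 ^ j) (2 ^ (j + 1)), x n ^ 2)

/-! Cut the indices into superblocks `2 ^ 2 ^ k ≤ n < N`, where `N = 2 ^ 2 ^ (k + 1)`. A superblock
consists of `2 ^ k` dyadic blocks, so monotonicity of `s` bounds its sum of squares by `2 ^ k *
s_{2^k} ^ 2`. For uniformly random signs, Hoeffding's inequality says that one partial sum at one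
point `t` exceeds `√(28 * 2 ^ k)` times the `ℓ²` norm of its coefficients with probability at most
`2 * exp (-14 * 2 ^ k)`. The partial sums and a grid of `8 * N ^ 3` points give only `2 ^ O(2 ^ k)`
such events, so a union bound suffices, and at most `2 ^ (N - 2 ^ k)` sign strings of length `N` are
bad. For good signs the sums over a superblock are `O(2 ^ k * s_{2^k}) + O(2 ^ (-k))` uniformly in
`t`. By Cauchy condensation these bounds are summable, and the partial sums are uniformly Cauchy.

For an individual complex string, compression replaces Borel–Cantelli. Once the coefficients are
replaced by exact rational approximations, badness is decidable uniformly in `k`. A bad string is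
then described by `k` in unary followed by its rank in exactly `N - 2 ^ k` bits. This prefix-free
description has length `k + 1 + N - 2 ^ k`, which falls below `N - c` for every constant `c` when
`k` is large, so a complex string is bad only finitely often.

The two halves are `IsKolmogorovChaitinComplex.eventually_rademacher_sum_sq_le` (randomness) and
`abs_sum_superblock_le` (deterministic analysis); `exists_tendstoUniformly_of_block_bound` sums the
block estimates. -/

/-! ### Compressing the members of small decidable sets -/

/-- The natural number with the binary digits `u`, least significant digit first. -/
def binaryValue (u : List Bool) : ℕ := u.foldr (fun b r => b.toNat + 2 * r) 0

theorem primrec_binaryValue : Primrec binaryValue := by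
  have hb : Primrec Bool.toNat := Primrec.dom_finite _
  exact Primrec.list_foldr (h := fun (_ : List Bool) (p : Bool × ℕ) => p.1.toNat + 2 * p.2) Primrec.id (Primrec.const 0)
    (Primrec.nat_add.comp (hb.comp (Primrec.fst.comp Primrec.snd))
      (Primrec.nat_mul.comp (Primrec.const 2) (Primrec.snd.comp Primrec.snd))).to₂

/-- Ranks are padded to a prescribed number of digits: the fixed length is what makes the listing
machine prefix-free. -/
theorem exists_binaryValue_eq {L i : ℕ} (hi : i < 2 ^ L) :
    ∃ u : List Bool, u.length = L ∧ binaryValue u = i := by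
  induction L generalizing i with
  | zero => exact ⟨[], rfl, by simp [binaryValue]; omega⟩
  | succ L ih =>
    obtain ⟨u, hu, hv⟩ := ih (i := i / 2) (by rw [pow_succ] at hi; omega)
    refine ⟨decide (i % 2 = 1) :: u, by simp [hu], ?_⟩
    change (decide (i % 2 = 1)).toNat + 2 * binaryValue u = i
    rw [hv]
    by_cases h : i % 2 = 1
    · simp [h]; omega
    · simp [h]; omega

/-- The number `z` codes a string of length `N k` that satisfies the test `bad k`. -/
def codesBad (N : ℕ → ℕ) (bad : ℕ → List Bool → Bool) (k z : ℕ) : Bool :=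
  ((Encodable.decode (α := List Bool) z).map fun σ =>
    bad k σ && (decide (σ.length = N k) && decide (Encodable.encode σ = z))).getD false

theorem codesBad_eq_true {N : ℕ → ℕ} {bad : ℕ → List Bool → Bool} {k z : ℕ} :
    codesBad N bad k z = true ↔
      ∃ σ : List Bool, Encodable.decode z = some σ ∧ bad k σ = true ∧
        σ.length = N k ∧ Encodable.encode σ = z := by
  unfold codesBad
  rcases h : Encodable.decode (α := List Bool) z with _ | σ <;> simp

theorem computable_codesBad {N : ℕ → ℕ} {bad : ℕ → List Bool → Bool} (hN : Computable N)
    (hbad : Computable₂ bad) : Computable₂ (codesBad N bad) := by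
  have hg : Computable fun b : (ℕ × ℕ) × List Bool =>
      (bad b.1.1 b.2 && (decide (b.2.length = N b.1.1) &&
        decide (Encodable.encode b.2 = b.1.2))) := by
    have heq : Computable₂ fun a b : ℕ => decide (a = b) :=
      (PrimrecRel.decide (Primrec.eq (α := ℕ))).to_comp
    refine Primrec.and.to_comp.comp
      (hbad.comp (Computable.fst.comp Computable.fst) Computable.snd)
      (Primrec.and.to_comp.comp ?_ ?_)
    · exact heq.comp (Computable.list_length.comp Computable.snd)
        (hN.comp (Computable.fst.comp Computable.fst))
    · exact heq.comp (Computable.encode.comp Computable.snd)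
        (Computable.snd.comp Computable.fst)
  exact Computable.option_getD (Computable.option_map (Computable.decode.comp Computable.snd)
    hg.to₂) (Computable.const false)

theorem Computable₂.count {p : ℕ → ℕ → Bool} (hp : Computable₂ p) :
    Computable₂ fun k z => Nat.count (fun z => p k z = true) z := by
  have h : Computable fun a : ℕ × ℕ => (Nat.rec 0
      (fun y r => bif p a.1 y then r + 1 else r) a.2 : ℕ) := by
    refine Computable.nat_rec (h := fun a q => bif p a.1 q.1 then q.2 + 1 else q.2)
      Computable.snd (Computable.const 0) ?_
    have h2 : Computable fun b : (ℕ × ℕ) × (ℕ × ℕ) => b.2.2 :=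
      Computable.snd.comp Computable.snd
    exact (Computable.cond (hp.comp (Computable.fst.comp Computable.fst)
      (Computable.fst.comp Computable.snd)) (Computable.succ.comp h2) h2).to₂
  refine h.of_eq fun ⟨k, z⟩ => ?_
  induction z with
  | zero => simp
  | succ z ih =>
    dsimp only at ih ⊢
    rw [Nat.count_succ, ih]
    cases p k z <;> simp

/-- On the input `0ᵏ1u`, where `u` has length `L k`, this machine outputs the string of length
`N k` satisfying `bad k` whose rank is the number with the binary digits `u`. -/
def listingMachine (N L : ℕ → ℕ) (bad : ℕ → List Bool → Bool) (l : List Bool) :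
    Part (List Bool) :=
  Nat.rfindOpt fun z =>
    bif l.contains true && decide ((l.drop (l.idxOf true + 1)).length = L (l.idxOf true)) &&
      (codesBad N bad (l.idxOf true) z && decide
        (Nat.count (fun y => codesBad N bad (l.idxOf true) y = true) z =
          binaryValue (l.drop (l.idxOf true + 1))))
    then Encodable.decode z else none

theorem partrec_listingMachine {N L : ℕ → ℕ} {bad : ℕ → List Bool → Bool} (hN : Computable N)
    (hL : Computable L) (hbad : Computable₂ bad) : Partrec (listingMachine N L bad) := by
  have hi : Primrec fun a : List Bool × ℕ => a.1.idxOf true :=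
    Primrec.list_idxOf.comp (Primrec.const true) Primrec.fst
  have hb : Primrec fun a : List Bool × ℕ => a.1.contains true := by
    refine ((PrimrecRel.decide Primrec.nat_lt).comp hi
      (Primrec.list_length.comp Primrec.fst)).of_eq fun a => ?_
    rw [Bool.eq_iff_iff]
    simpa using List.idxOf_lt_length_iff
  have hd : Primrec fun a : List Bool × ℕ => a.1.drop (a.1.idxOf true + 1) :=
    Primrec.list_drop.comp (Primrec.succ.comp hi) Primrec.fst
  have heq : Computable₂ fun a b : ℕ => decide (a = b) :=
    (PrimrecRel.decide (Primrec.eq (α := ℕ))).to_comp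
  have hB := computable_codesBad hN hbad
  have h : Computable fun a : List Bool × ℕ =>
      bif a.1.contains true &&
        decide ((a.1.drop (a.1.idxOf true + 1)).length = L (a.1.idxOf true)) &&
        (codesBad N bad (a.1.idxOf true) a.2 && decide
        (Nat.count (fun y => codesBad N bad (a.1.idxOf true) y = true) a.2 =
          binaryValue (a.1.drop (a.1.idxOf true + 1))))
      then Encodable.decode (α := List Bool) a.2 else none := by
    refine Computable.cond ?_ (Computable.decode.comp Computable.snd) (Computable.const none)
    refine Primrec.and.to_comp.comp (Primrec.and.to_comp.comp hb.to_comp ?_)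
      (Primrec.and.to_comp.comp (hB.comp hi.to_comp Computable.snd) ?_)
    · exact heq.comp (Primrec.list_length.comp hd).to_comp (hL.comp hi.to_comp)
    · exact heq.comp (hB.count.comp hi.to_comp Computable.snd)
        (primrec_binaryValue.comp hd).to_comp
  exact Partrec.rfindOpt h.to₂

theorem mem_listingMachine_spec {N L : ℕ → ℕ} {bad : ℕ → List Bool → Bool} {l σ : List Bool}
    (h : σ ∈ listingMachine N L bad l) :
    true ∈ l ∧ (l.drop (l.idxOf true + 1)).length = L (l.idxOf true) ∧
      ∃ z, codesBad N bad (l.idxOf true) z = true ∧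
        Nat.count (fun y => codesBad N bad (l.idxOf true) y = true) z =
          binaryValue (l.drop (l.idxOf true + 1)) ∧ Encodable.decode z = some σ := by
  obtain ⟨z, hz⟩ := Nat.rfindOpt_spec h
  rw [Option.mem_def, Bool.cond_eq_ite] at hz
  split_ifs at hz with hc
  simp only [Bool.and_eq_true, List.contains_iff_mem, decide_eq_true_eq] at hc
  exact ⟨hc.1.1, hc.1.2, z, hc.2.1, hc.2.2, hz⟩

/-- The leading zeros of a program determine `k`, and `k` determines the length of what follows the
separator, so a halting program has no halting proper extension. -/
theorem isPrefixFreeMachine_listingMachine {N L : ℕ → ℕ} {bad : ℕ → List Bool → Bool}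
    (hN : Computable N) (hL : Computable L) (hbad : Computable₂ bad) :
    IsPrefixFreeMachine (listingMachine N L bad) := by
  refine ⟨partrec_listingMachine hN hL hbad, fun l m hl hm hlm => ?_⟩
  obtain ⟨σ, hσ⟩ := Part.dom_iff_mem.1 hl
  obtain ⟨τ, hτ⟩ := Part.dom_iff_mem.1 hm
  obtain ⟨hl1, hl2, -⟩ := mem_listingMachine_spec hσ
  obtain ⟨-, hm2, -⟩ := mem_listingMachine_spec hτ
  obtain ⟨r, rfl⟩ := hlm
  have hidx : (l ++ r).idxOf true = l.idxOf true := List.idxOf_append_of_mem hl1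
  have hlt : l.idxOf true + 1 ≤ l.length := List.idxOf_lt_length_iff.2 hl1
  rw [hidx, List.drop_append_of_le_length hlt, List.length_append] at hm2
  have hr : r = [] := List.length_eq_zero_iff.1 (by omega)
  simp [hr]

theorem drop_replicate_append (e : ℕ) (p : List Bool) :
    (List.replicate e false ++ true :: p).drop (e + 1) = p := by
  rw [show List.replicate e false ++ true :: p = (List.replicate e false ++ [true]) ++ p by simp,
    List.drop_left' (by simp)]

/-- The search cannot stop at a different string, because counting the smaller hits is injective on
the hits themselves. -/
theorem mem_listingMachine {N L : ℕ → ℕ} {bad : ℕ → List Bool → Bool} {k : ℕ} {u σ : List Bool}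
    (hu : u.length = L k) (hσ : σ.length = N k) (hb : bad k σ = true)
    (hc : binaryValue u =
      Nat.count (fun y => codesBad N bad k y = true) (Encodable.encode σ)) :
    σ ∈ listingMachine N L bad (List.replicate k false ++ true :: u) := by
  have hbσ : codesBad N bad k (Encodable.encode σ) = true :=
    codesBad_eq_true.2 ⟨σ, by simp, hb, hσ, rfl⟩
  have hdom : (listingMachine N L bad (List.replicate k false ++ true :: u)).Dom := by
    refine Nat.rfindOpt_dom.2 ⟨Encodable.encode σ, σ, ?_⟩
    rw [idxOf_replicate_append, drop_replicate_append]
    simp [hu, hbσ, hc]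
  obtain ⟨τ, hτ⟩ := Part.dom_iff_mem.1 hdom
  obtain ⟨-, -, z, hz, hzc, hzτ⟩ := mem_listingMachine_spec hτ
  rw [idxOf_replicate_append] at hz hzc
  rw [drop_replicate_append, hc] at hzc
  have := Nat.count_injective hz hbσ hzc
  rw [this, Encodable.encodek] at hzτ
  rw [Option.some.inj hzτ]
  exact hτ

theorem count_codesBad_lt {N : ℕ → ℕ} {bad : ℕ → List Bool → Bool} {k : ℕ} {σ : List Bool}
    (hσ : σ.length = N k) (hb : bad k σ = true) :
    Nat.count (fun y => codesBad N bad k y = true) (Encodable.encode σ) <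
      (Finset.univ.filter fun v : Fin (N k) → Bool => bad k (List.ofFn v) = true).card := by
  set F := (Finset.univ.filter fun v : Fin (N k) → Bool => bad k (List.ofFn v) = true)
  -- The clause `encode σ = z` in `codesBad` admits canonical codes only, so every bad string is
  -- counted once.
  have hsub : {y | codesBad N bad k y = true} ⊆
      (F.image fun v => Encodable.encode (List.ofFn v) : Finset ℕ) := by
    intro y hy
    obtain ⟨τ, -, hbτ, hlen, hy'⟩ := codesBad_eq_true.1 hy
    have h : List.ofFn (fun i : Fin (N k) => τ.get (i.cast hlen.symm)) = τ := by
      rw [← List.ofFn_congr hlen, List.ofFn_get]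
    refine Finset.mem_coe.2 (Finset.mem_image.2 ⟨fun i => τ.get (i.cast hlen.symm), ?_, ?_⟩)
    · simp only [F, Finset.mem_filter, Finset.mem_univ, true_and, h, hbτ]
    · rw [h, hy']
  have hfin : {y | codesBad N bad k y = true}.Finite := (Finset.finite_toSet _).subset hsub
  refine (Nat.count_lt_card hfin (codesBad_eq_true.2 ⟨σ, by simp, hb, hσ, rfl⟩)).trans_le ?_
  exact (Finset.card_le_card fun y hy => Finset.mem_coe.1 (hsub (hfin.mem_toFinset.1 hy))).trans
    Finset.card_image_le

/-- A complex string passes almost all tests of a computable sequence of small tests. -/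
theorem IsKolmogorovChaitinComplex.eventually_passes {α : ℕ → Bool}
    (hα : IsKolmogorovChaitinComplex α) {N L : ℕ → ℕ} {bad : ℕ → List Bool → Bool}
    (hN : Computable N) (hL : Computable L) (hbad : Computable₂ bad)
    (hcard : ∀ k, (Finset.univ.filter fun v : Fin (N k) → Bool =>
      bad k (List.ofFn v) = true).card ≤ 2 ^ L k)
    (hgap : ∀ d : ℕ, ∀ᶠ k : ℕ in atTop, k + L k + d < N k) :
    ∀ᶠ k in atTop, bad k ((List.range (N k)).map α) = false := by
  obtain ⟨m, hm⟩ := hα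
  obtain ⟨d, hd⟩ := kolmogorovComplexity_le (isPrefixFreeMachine_listingMachine hN hL hbad)
  -- The three losses are the separator bit, the constant of the invariance theorem and the
  -- randomness deficiency of `α`.
  filter_upwards [hgap (1 + d + m)] with k hk
  by_contra hb
  rw [Bool.not_eq_false] at hb
  have hlen : ((List.range (N k)).map α).length = N k := by simp
  obtain ⟨u, hu, hv⟩ := exists_binaryValue_eq
    ((count_codesBad_lt hlen hb).trans_le (hcard k))
  have hmem := mem_listingMachine hu hlen hb hv
  have h1 : machineComplexity (listingMachine N L bad) ((List.range (N k)).map α) ≤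
      ((k + (L k + 1) : ℕ) : ℕ∞) := by
    unfold machineComplexity
    refine iInf₂_le_of_le _ hmem (le_of_eq ?_)
    simp [hu]
  have h2 : ((N k : ℕ) : ℕ∞) ≤ ((k + (L k + 1) + d + m : ℕ) : ℕ∞) := by
    refine (hm (N k)).trans ?_
    push_cast at h1 ⊢
    gcongr
    refine (hd _).trans ?_
    gcongr
  have h3 : N k ≤ k + (L k + 1) + d + m := by exact_mod_cast h2
  omega

/-! ### Exact rational and approximate real computation -/

section ComputableReal

variable {α β : Type*} [Primcodable α] [Primcodable β]

/-- The rational number `(a - b) / (c + 1)`. -/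
noncomputable def tripleValue (t : (ℕ × ℕ) × ℕ) : ℝ := ((t.1.1 : ℝ) - t.1.2) / ((t.2 : ℝ) + 1)

/-- The function `f` takes rational values, and these can be computed exactly. -/
def IsComputableRat (f : α → ℝ) : Prop :=
  ∃ g : α → (ℕ × ℕ) × ℕ, Computable g ∧ ∀ x, f x = tripleValue (g x)

/-- The sum of two coded rational numbers. -/
def tripleAdd (s t : (ℕ × ℕ) × ℕ) : (ℕ × ℕ) × ℕ :=
  ((s.1.1 * (t.2 + 1) + t.1.1 * (s.2 + 1), s.1.2 * (t.2 + 1) + t.1.2 * (s.2 + 1)),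
    s.2 * t.2 + (s.2 + t.2))

/-- The product of two coded rational numbers. -/
def tripleMul (s t : (ℕ × ℕ) × ℕ) : (ℕ × ℕ) × ℕ :=
  ((s.1.1 * t.1.1 + s.1.2 * t.1.2, s.1.1 * t.1.2 + s.1.2 * t.1.1), s.2 * t.2 + (s.2 + t.2))

theorem tripleValue_add (s t : (ℕ × ℕ) × ℕ) :
    tripleValue (tripleAdd s t) = tripleValue s + tripleValue t := by
  have h1 : (s.2 : ℝ) + 1 ≠ 0 := by positivity
  have h2 : (t.2 : ℝ) + 1 ≠ 0 := by positivity
  -- Denominators are stored minus one, which keeps them nonzero; this is the product of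
  -- denominators in that encoding.
  have h3 : ((s.2 * t.2 + (s.2 + t.2) : ℕ) : ℝ) + 1 = (s.2 + 1) * (t.2 + 1) := by
    push_cast; ring
  unfold tripleValue tripleAdd
  rw [h3]
  push_cast
  field_simp
  ring

theorem tripleValue_mul (s t : (ℕ × ℕ) × ℕ) :
    tripleValue (tripleMul s t) = tripleValue s * tripleValue t := by
  have h1 : (s.2 : ℝ) + 1 ≠ 0 := by positivity
  have h2 : (t.2 : ℝ) + 1 ≠ 0 := by positivity
  have h3 : ((s.2 * t.2 + (s.2 + t.2) : ℕ) : ℝ) + 1 = (s.2 + 1) * (t.2 + 1) := by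
    push_cast; ring
  unfold tripleValue tripleMul
  rw [h3]
  push_cast
  field_simp
  ring

theorem primrec_tripleAdd : Primrec₂ tripleAdd := by
  have s1 : Primrec fun p : ((ℕ × ℕ) × ℕ) × ((ℕ × ℕ) × ℕ) => p.1.1.1 :=
    Primrec.fst.comp (Primrec.fst.comp Primrec.fst)
  have s2 : Primrec fun p : ((ℕ × ℕ) × ℕ) × ((ℕ × ℕ) × ℕ) => p.1.1.2 :=
    Primrec.snd.comp (Primrec.fst.comp Primrec.fst)
  have s3 : Primrec fun p : ((ℕ × ℕ) × ℕ) × ((ℕ × ℕ) × ℕ) => p.1.2 :=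
    Primrec.snd.comp Primrec.fst
  have t1 : Primrec fun p : ((ℕ × ℕ) × ℕ) × ((ℕ × ℕ) × ℕ) => p.2.1.1 :=
    Primrec.fst.comp (Primrec.fst.comp Primrec.snd)
  have t2 : Primrec fun p : ((ℕ × ℕ) × ℕ) × ((ℕ × ℕ) × ℕ) => p.2.1.2 :=
    Primrec.snd.comp (Primrec.fst.comp Primrec.snd)
  have t3 : Primrec fun p : ((ℕ × ℕ) × ℕ) × ((ℕ × ℕ) × ℕ) => p.2.2 :=
    Primrec.snd.comp Primrec.snd
  have A := Primrec.nat_add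
  have M := Primrec.nat_mul
  exact ((A.comp (M.comp s1 (Primrec.succ.comp t3)) (M.comp t1 (Primrec.succ.comp s3))).pair
    (A.comp (M.comp s2 (Primrec.succ.comp t3)) (M.comp t2 (Primrec.succ.comp s3)))).pair
    (A.comp (M.comp s3 t3) (A.comp s3 t3))

theorem primrec_tripleMul : Primrec₂ tripleMul := by
  have s1 : Primrec fun p : ((ℕ × ℕ) × ℕ) × ((ℕ × ℕ) × ℕ) => p.1.1.1 :=
    Primrec.fst.comp (Primrec.fst.comp Primrec.fst)
  have s2 : Primrec fun p : ((ℕ × ℕ) × ℕ) × ((ℕ × ℕ) × ℕ) => p.1.1.2 :=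
    Primrec.snd.comp (Primrec.fst.comp Primrec.fst)
  have s3 : Primrec fun p : ((ℕ × ℕ) × ℕ) × ((ℕ × ℕ) × ℕ) => p.1.2 :=
    Primrec.snd.comp Primrec.fst
  have t1 : Primrec fun p : ((ℕ × ℕ) × ℕ) × ((ℕ × ℕ) × ℕ) => p.2.1.1 :=
    Primrec.fst.comp (Primrec.fst.comp Primrec.snd)
  have t2 : Primrec fun p : ((ℕ × ℕ) × ℕ) × ((ℕ × ℕ) × ℕ) => p.2.1.2 :=
    Primrec.snd.comp (Primrec.fst.comp Primrec.snd)
  have t3 : Primrec fun p : ((ℕ × ℕ) × ℕ) × ((ℕ × ℕ) × ℕ) => p.2.2 :=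
    Primrec.snd.comp Primrec.snd
  have A := Primrec.nat_add
  have M := Primrec.nat_mul
  exact ((A.comp (M.comp s1 t1) (M.comp s2 t2)).pair
    (A.comp (M.comp s1 t2) (M.comp s2 t1))).pair
    (A.comp (M.comp s3 t3) (A.comp s3 t3))

theorem Computable.nat_pow {f g : α → ℕ} (hf : Computable f) (hg : Computable g) :
    Computable fun x => f x ^ g x :=
  ((Primrec₂.unpaired'.1 Nat.Primrec.pow).to_comp).comp hf hg

namespace IsComputableRat

theorem comp {f : α → ℝ} (hf : IsComputableRat f) {h : β → α} (hh : Computable h) :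
    IsComputableRat fun x => f (h x) := by
  obtain ⟨g, hg, hfg⟩ := hf
  exact ⟨fun x => g (h x), hg.comp hh, fun x => hfg _⟩

theorem add {f g : α → ℝ} (hf : IsComputableRat f) (hg : IsComputableRat g) :
    IsComputableRat fun x => f x + g x := by
  obtain ⟨F, hF, hf⟩ := hf
  obtain ⟨G, hG, hg⟩ := hg
  exact ⟨fun x => tripleAdd (F x) (G x), primrec_tripleAdd.to_comp.comp hF hG, fun x => by
    simp only [tripleValue_add, hf, hg]⟩

theorem mul {f g : α → ℝ} (hf : IsComputableRat f) (hg : IsComputableRat g) :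
    IsComputableRat fun x => f x * g x := by
  obtain ⟨F, hF, hf⟩ := hf
  obtain ⟨G, hG, hg⟩ := hg
  exact ⟨fun x => tripleMul (F x) (G x), primrec_tripleMul.to_comp.comp hF hG, fun x => by
    simp only [tripleValue_mul, hf, hg]⟩

theorem natCast {g : α → ℕ} (hg : Computable g) : IsComputableRat fun x => (g x : ℝ) :=
  ⟨fun x => ((g x, 0), 0), (hg.pair (Computable.const 0)).pair (Computable.const 0),
    fun x => by simp [tripleValue]⟩

theorem const_natCast (n : ℕ) : IsComputableRat fun _ : α => (n : ℝ) :=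
  natCast (Computable.const n)

theorem const_neg_one : IsComputableRat fun _ : α => (-1 : ℝ) :=
  ⟨fun _ => ((0, 1), 0), Computable.const _, fun x => by simp [tripleValue]⟩

theorem inv_natCast {g : α → ℕ} (hg : Computable g) :
    IsComputableRat fun x => ((g x : ℝ))⁻¹ := by
  have hs : Computable₂ fun a b : ℕ => a - b := Primrec.nat_sub.to_comp
  -- The numerator `1 - (1 - g x)` is truncated: it is `0` when `g x = 0`, in agreement with `0⁻¹ =
  -- 0`, and `1` otherwise.
  refine ⟨fun x => ((1 - (1 - g x), 0), g x - 1), ((hs.comp (Computable.const 1)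
    (hs.comp (Computable.const 1) hg)).pair (Computable.const 0)).pair
    (hs.comp hg (Computable.const 1)), fun x => ?_⟩
  unfold tripleValue
  rcases Nat.eq_zero_or_pos (g x) with h | h
  · simp [h]
  · have h1 : 1 - (1 - g x) = 1 := by omega
    simp only [h1, Nat.cast_sub h]
    simp

theorem ite {c : α → Bool} (hc : Computable c) {f g : α → ℝ} (hf : IsComputableRat f)
    (hg : IsComputableRat g) : IsComputableRat fun x => if c x = true then f x else g x := by
  obtain ⟨F, hF, hf⟩ := hf
  obtain ⟨G, hG, hg⟩ := hg
  refine ⟨fun x => bif c x then F x else G x, Computable.cond hc hF hG, fun x => ?_⟩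
  dsimp only
  cases c x <;> simp [hf, hg]

/-- Strict comparison is undecidable for computable reals but decidable for exact rationals, by
cross-multiplication in `ℕ`. This is why the tests use rational coefficients. -/
theorem lt {f g : α → ℝ} (hf : IsComputableRat f) (hg : IsComputableRat g) :
    ∃ c : α → Bool, Computable c ∧ ∀ x, c x = true ↔ f x < g x := by
  obtain ⟨F, hF, hf⟩ := hf
  obtain ⟨G, hG, hg⟩ := hg
  have A := Primrec.nat_add.to_comp
  have M := Primrec.nat_mul.to_comp
  have hl : Computable₂ fun a b : ℕ => decide (a < b) :=
    (PrimrecRel.decide Primrec.nat_lt).to_comp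
  have f1 := Computable.fst.comp (Computable.fst.comp hF)
  have f2 := Computable.snd.comp (Computable.fst.comp hF)
  have f3 := Computable.succ.comp (Computable.snd.comp hF)
  have g1 := Computable.fst.comp (Computable.fst.comp hG)
  have g2 := Computable.snd.comp (Computable.fst.comp hG)
  have g3 := Computable.succ.comp (Computable.snd.comp hG)
  refine ⟨fun x => decide ((F x).1.1 * ((G x).2 + 1) + (G x).1.2 * ((F x).2 + 1) <
    (G x).1.1 * ((F x).2 + 1) + (F x).1.2 * ((G x).2 + 1)),
    hl.comp (A.comp (M.comp f1 g3) (M.comp g2 f3)) (A.comp (M.comp g1 f3) (M.comp f2 g3)),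
    fun x => ?_⟩
  rw [hf, hg, tripleValue, tripleValue, div_lt_div_iff₀ (by positivity) (by positivity),
    decide_eq_true_eq, ← Nat.cast_lt (α := ℝ)]
  push_cast
  constructor <;> intro h <;> nlinarith

/-- A recursion on real values is computable as soon as each step lifts to the coding triples;
finite sums and the doubling scheme for `cos` are instances. -/
theorem natRec {f : α → ℝ} (hf : IsComputableRat f) {n : α → ℕ} (hn : Computable n)
    {G : α → ℕ × ((ℕ × ℕ) × ℕ) → (ℕ × ℕ) × ℕ} (hG : Computable₂ G) {S : α → ℕ → ℝ → ℝ}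
    (hS : ∀ x i t, tripleValue (G x (i, t)) = S x i (tripleValue t)) :
    IsComputableRat fun x => (Nat.rec (f x) (fun i r => S x i r) (n x) : ℝ) := by
  obtain ⟨F, hF, hf⟩ := hf
  have key : ∀ x m, (Nat.rec (f x) (fun i r => S x i r) m : ℝ) =
      tripleValue (Nat.rec (F x) (fun i t => G x (i, t)) m) := by
    intro x m
    induction m with
    | zero => exact hf x
    | succ m ih =>
      change S x m _ = tripleValue (G x (m, _))
      rw [hS, ih]
  exact ⟨_, Computable.nat_rec hn hF hG, fun x => key x (n x)⟩

theorem sum_range {f : α × ℕ → ℝ} (hf : IsComputableRat f) {n : α → ℕ} (hn : Computable n) :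
    IsComputableRat fun x => ∑ i ∈ Finset.range (n x), f (x, i) := by
  obtain ⟨F, hF, hf⟩ := hf
  have h := natRec (f := fun _ : α => (0 : ℝ)) (by simpa using const_natCast (α := α) 0) hn
    (G := fun x p => tripleAdd p.2 (F (x, p.1))) (S := fun x i r => r + f (x, i))
    (primrec_tripleAdd.to_comp.comp (Computable.snd.comp Computable.snd)
      (hF.comp (Computable.fst.pair (Computable.fst.comp Computable.snd)))).to₂
    (fun x i t => by rw [tripleValue_add, hf])
  convert h using 2 with x
  induction n x with
  | zero => simp
  | succ m ih => rw [Finset.sum_range_succ, ih]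

end IsComputableRat

/-- Rational approximations of `cos`: for `r = 2 ^ s * u` the duplication formula is applied `s`
times to the approximation `1 - u ^ 2 / 2` of `cos u`. -/
noncomputable def cosApprox (r : ℝ) (s : ℕ) : ℝ :=
  Nat.rec (1 + -1 * (2 : ℝ)⁻¹ * (r * ((2 : ℝ) ^ s)⁻¹ * (r * ((2 : ℝ) ^ s)⁻¹)))
    (fun _ c => 2 * (c * c) + -1) s

/-- The initial error is at most `u ^ 4`, and each of the `s` duplications multiplies it by at most
`6`. Since `u = r / 2 ^ s`, the total is `|r| ^ 4 * (6 / 16) ^ s ≤ 2 ^ (4 * B) * 2 ^ (-s)`, which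
dictates `s = 4 * B + m`. -/
theorem abs_cosApprox_sub_cos_le {r : ℝ} {B : ℕ} (hr : |r| ≤ B) (m : ℕ) :
    |cosApprox r (4 * B + m) - Real.cos r| ≤ (1 / 2 : ℝ) ^ m := by
  set s := 4 * B + m with hs
  set u := r * ((2 : ℝ) ^ s)⁻¹ with hu
  set c₀ := 1 + -1 * (2 : ℝ)⁻¹ * (u * u) with hc₀
  have hB : (B : ℝ) ≤ 2 ^ B := by exact_mod_cast B.lt_two_pow_self.le
  have hBs : (2 : ℝ) ^ B ≤ 2 ^ s := pow_le_pow_right₀ (by norm_num) (by omega)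
  have habs : |u| = |r| * ((2 : ℝ) ^ s)⁻¹ := by
    rw [hu, abs_mul, abs_of_pos (a := ((2 : ℝ) ^ s)⁻¹) (by positivity)]
  have hu1 : |u| ≤ 1 := by
    rw [habs, ← div_eq_mul_inv]
    exact div_le_one_of_le₀ (by linarith) (by positivity)
  have h0 : |c₀ - Real.cos u| ≤ |u| ^ 4 := by
    have := Real.cos_bound hu1
    rw [abs_sub_comm] at this
    have h4 : 0 ≤ |u| ^ 4 := by positivity
    calc |c₀ - Real.cos u| = |1 - u ^ 2 / 2 - Real.cos u| := by rw [hc₀]; ring_nf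
      _ ≤ |u| ^ 4 * (5 / 96) := this
      _ ≤ |u| ^ 4 := by linarith
  have hfin : 6 ^ s * |u| ^ 4 ≤ (1 / 2 : ℝ) ^ m := by
    have h1 : |r| ^ 4 ≤ 2 ^ (4 * B) := by
      calc |r| ^ 4 ≤ (2 ^ B) ^ 4 := by gcongr; linarith
        _ = 2 ^ (4 * B) := by rw [← pow_mul, mul_comm]
    calc 6 ^ s * |u| ^ 4 = |r| ^ 4 * (3 / 8 : ℝ) ^ s := by
          rw [habs, mul_pow, inv_pow, ← pow_mul, mul_comm s 4, pow_mul,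
            show (3 / 8 : ℝ) = 6 * 16⁻¹ by norm_num, mul_pow, inv_pow]
          norm_num
          ring
      _ ≤ 2 ^ (4 * B) * (1 / 2 : ℝ) ^ s := by
          refine mul_le_mul h1 (pow_le_pow_left₀ (by norm_num) (by norm_num) s)
            (by positivity) (by positivity)
      _ = (1 / 2 : ℝ) ^ m := by
          rw [hs, pow_add, ← mul_assoc, ← mul_pow]; norm_num
  have hm1 : (1 / 2 : ℝ) ^ m ≤ 1 := pow_le_one₀ (by norm_num) (by norm_num)
  have key : ∀ i ≤ s, |(Nat.rec c₀ (fun _ c => 2 * (c * c) + -1) i : ℝ) -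
      Real.cos (2 ^ i * u)| ≤ 6 ^ i * |u| ^ 4 := by
    intro i
    induction i with
    | zero => intro _; simpa using h0
    | succ i ih =>
      intro hi
      have ih := ih (by omega)
      set c : ℝ := Nat.rec c₀ (fun _ c => 2 * (c * c) + -1) i
      set x := Real.cos (2 ^ i * u)
      have hx : |x| ≤ 1 := Real.abs_cos_le_one _
      -- The error so far is at most `1`, hence `|c| ≤ 2` and `|2 * (c + x)| ≤ 6`; this is the
      -- growth factor of the next step.
      have hle1 : 6 ^ i * |u| ^ 4 ≤ 1 := by
        refine le_trans ?_ (hfin.trans hm1)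
        gcongr
        · norm_num
        · omega
      have e1 : Real.cos (2 ^ (i + 1) * u) = 2 * x ^ 2 - 1 := by
        rw [← Real.cos_two_mul]; ring_nf
      change |2 * (c * c) + -1 - _| ≤ _
      rw [e1]
      have e2 : 2 * (c * c) + -1 - (2 * x ^ 2 - 1) = (c - x) * (2 * (c + x)) := by ring
      have e3 : |2 * (c + x)| ≤ 6 := by
        rw [abs_le] at hx ih ⊢
        constructor <;> linarith [ih.1, ih.2, hx.1, hx.2]
      rw [e2, abs_mul]
      calc |c - x| * |2 * (c + x)| ≤ (6 ^ i * |u| ^ 4) * 6 := by gcongr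
        _ = 6 ^ (i + 1) * |u| ^ 4 := by ring
  have := key s le_rfl
  have hru : 2 ^ s * u = r := by rw [hu]; field_simp
  rw [hru] at this
  exact this.trans hfin

theorem IsComputableRat.cosApprox {f : α → ℝ} (hf : IsComputableRat f) {s : α → ℕ}
    (hs : Computable s) : IsComputableRat fun x => cosApprox (f x) (s x) := by
  have hi2 : IsComputableRat fun _ : α => (2 : ℝ)⁻¹ := by
    simpa using IsComputableRat.inv_natCast (Computable.const (α := α) 2)
  have hi : IsComputableRat fun x => ((2 : ℝ) ^ s x)⁻¹ := by
    simpa using IsComputableRat.inv_natCast (Computable.nat_pow (Computable.const 2) hs)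
  have h1 : IsComputableRat fun _ : α => (1 : ℝ) := by
    simpa using IsComputableRat.const_natCast (α := α) 1
  have hu := hf.mul hi
  have hb := h1.add ((IsComputableRat.const_neg_one.mul hi2).mul (hu.mul hu))
  refine IsComputableRat.natRec hb hs
    (G := fun _ p => tripleAdd (tripleMul ((2, 0), 0) (tripleMul p.2 p.2)) ((0, 1), 0)) ?_
    (fun x i t => ?_)
  · have hp : Computable fun q : α × ℕ × ((ℕ × ℕ) × ℕ) => q.2.2 :=
      Computable.snd.comp Computable.snd
    have hM := primrec_tripleMul.to_comp
    exact (primrec_tripleAdd.to_comp.comp (hM.comp (Computable.const _) (hM.comp hp hp))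
      (Computable.const _)).to₂
  · rw [tripleValue_add, tripleValue_mul, tripleValue_mul]
    simp [tripleValue]

/-- The values of `f` are real numbers that are computable uniformly in the argument. -/
def IsComputableReal (f : α → ℝ) : Prop :=
  ∃ r : α × ℕ → ℝ, IsComputableRat r ∧ ∀ x m, |f x - r (x, m)| ≤ (1 / 2 : ℝ) ^ m

theorem IsComputableRat.exists_natCast_bound {f : α → ℝ} (hf : IsComputableRat f) :
    ∃ B : α → ℕ, Computable B ∧ ∀ x, |f x| ≤ B x := by
  obtain ⟨F, hF, hf⟩ := hf
  refine ⟨fun x => (F x).1.1 + (F x).1.2, Primrec.nat_add.to_comp.comp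
    (Computable.fst.comp (Computable.fst.comp hF))
    (Computable.snd.comp (Computable.fst.comp hF)), fun x => ?_⟩
  rw [hf, tripleValue, abs_div, abs_of_pos (a := ((F x).2 : ℝ) + 1) (by positivity)]
  refine (div_le_self (abs_nonneg _) (by linarith [Nat.cast_nonneg (α := ℝ) (F x).2])).trans ?_
  refine (abs_sub _ _).trans (le_of_eq ?_)
  rw [Nat.abs_cast, Nat.abs_cast, Nat.cast_add]

namespace IsComputableReal

theorem comp {f : α → ℝ} (hf : IsComputableReal f) {h : β → α} (hh : Computable h) :
    IsComputableReal fun x => f (h x) := by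
  obtain ⟨r, hr, hfr⟩ := hf
  exact ⟨fun p => r (h p.1, p.2), hr.comp ((hh.comp Computable.fst).pair Computable.snd),
    fun x m => hfr _ _⟩

theorem _root_.IsComputableRat.isComputableReal {f : α → ℝ} (hf : IsComputableRat f) :
    IsComputableReal f :=
  ⟨fun p => f p.1, hf.comp Computable.fst, fun x m => by simp⟩

theorem add {f g : α → ℝ} (hf : IsComputableReal f) (hg : IsComputableReal g) :
    IsComputableReal fun x => f x + g x := by
  obtain ⟨r, hr, hf⟩ := hf
  obtain ⟨q, hq, hg⟩ := hg
  have hm : Computable fun p : α × ℕ => (p.1, p.2 + 1) :=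
    Computable.fst.pair (Computable.succ.comp Computable.snd)
  refine ⟨_, (hr.comp hm).add (hq.comp hm), fun x m => ?_⟩
  have h1 := hf x (m + 1)
  have h2 := hg x (m + 1)
  rw [pow_succ] at h1 h2
  rw [add_sub_add_comm]
  refine (abs_add_le _ _).trans ?_
  linarith

/-- Approximations of the factors yield approximations of a product, when the second factor is
bounded by `1`. -/
theorem mul_of_abs_le_one {f g : α → ℝ} (hf : IsComputableReal f) (hg : IsComputableReal g)
    (hg1 : ∀ x, |g x| ≤ 1) : IsComputableReal fun x => f x * g x := by
  obtain ⟨r, hr, hf⟩ := hf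
  obtain ⟨q, hq, hg⟩ := hg
  have hm : Computable fun p : α × ℕ => (p.1, p.2 + 1) :=
    Computable.fst.pair (Computable.succ.comp Computable.snd)
  have hr' := hr.comp hm
  obtain ⟨B, hB, hrB⟩ := hr'.exists_natCast_bound
  -- The second factor needs `B` extra bits, because its error is multiplied by `|R| ≤ B ≤ 2 ^ B`.
  have hm' : Computable fun p : α × ℕ => (p.1, p.2 + 1 + B p) :=
    Computable.fst.pair (Primrec.nat_add.to_comp.comp
      (Computable.succ.comp Computable.snd) hB)
  refine ⟨_, hr'.mul (hq.comp hm'), fun x m => ?_⟩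
  have h1 := hf x (m + 1)
  have h2 := hg x (m + 1 + B (x, m))
  have h3 := hrB (x, m)
  have hB2 : (B (x, m) : ℝ) ≤ 2 ^ B (x, m) := by exact_mod_cast (Nat.lt_two_pow_self).le
  dsimp only at h3 ⊢
  set R := r (x, m + 1)
  set Q := q (x, m + 1 + B (x, m))
  have e : f x * g x - R * Q = (f x - R) * g x + R * (g x - Q) := by ring
  rw [e]
  refine (abs_add_le _ _).trans ?_
  rw [abs_mul, abs_mul]
  have t1 : |f x - R| * |g x| ≤ (1 / 2 : ℝ) ^ (m + 1) * 1 := by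
    gcongr
    exact hg1 x
  have t2 : |R| * |g x - Q| ≤ 2 ^ B (x, m) * (1 / 2 : ℝ) ^ (m + 1 + B (x, m)) := by
    gcongr
    exact h3.trans hB2
  have t3 : (2 : ℝ) ^ B (x, m) * (1 / 2 : ℝ) ^ (m + 1 + B (x, m)) = (1 / 2 : ℝ) ^ (m + 1) := by
    rw [pow_add, mul_left_comm, ← mul_pow]; norm_num
  have t4 : (1 / 2 : ℝ) ^ (m + 1) + (1 / 2 : ℝ) ^ (m + 1) = (1 / 2 : ℝ) ^ m := by
    rw [pow_succ]; ring
  linarith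

theorem cos {f : α → ℝ} (hf : IsComputableReal f) :
    IsComputableReal fun x => Real.cos (f x) := by
  obtain ⟨r, hr, hf⟩ := hf
  have hm : Computable fun p : α × ℕ => (p.1, p.2 + 1) :=
    Computable.fst.pair (Computable.succ.comp Computable.snd)
  have hr' := hr.comp hm
  obtain ⟨B, hB, hrB⟩ := hr'.exists_natCast_bound
  have hs : Computable fun p : α × ℕ => 4 * B p + (p.2 + 1) :=
    Primrec.nat_add.to_comp.comp (Primrec.nat_mul.to_comp.comp (Computable.const 4) hB)
      (Computable.succ.comp Computable.snd)
  refine ⟨_, hr'.cosApprox hs, fun x m => ?_⟩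
  have h1 := (Real.abs_cos_sub_cos_le (f x) (r (x, m + 1))).trans (hf x (m + 1))
  have h2 := abs_cosApprox_sub_cos_le (hrB (x, m)) (m + 1)
  rw [abs_sub_comm] at h2
  refine (abs_sub_le _ (Real.cos (r (x, m + 1))) _).trans ?_
  rw [pow_succ] at h1 h2
  linarith

end IsComputableReal

theorem IsComputableRealSeq.isComputableReal {x : ℕ → ℝ} (hx : IsComputableRealSeq x) :
    IsComputableReal x := by
  obtain ⟨a, b, c, ha, hb, hc, h⟩ := hx
  exact ⟨fun p => tripleValue ((a p.1 p.2, b p.1 p.2), c p.1 p.2),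
    ⟨fun p => ((a p.1 p.2, b p.1 p.2), c p.1 p.2), (ha.pair hb).pair hc, fun _ => rfl⟩, h⟩

/-- A bounded existential quantifier preserves computability. -/
theorem Computable.exists_lt {p : α → ℕ → Bool} (hp : Computable₂ p) {n : α → ℕ}
    (hn : Computable n) :
    ∃ c : α → Bool, Computable c ∧ ∀ x, c x = true ↔ ∃ i < n x, p x i = true := by
  refine ⟨fun x => Nat.rec false (fun i b => p x i || b) (n x),
    Computable.nat_rec (h := fun x q => p x q.1 || q.2) hn (Computable.const false)
      (Primrec.or.to_comp.comp (hp.comp Computable.fst (Computable.fst.comp Computable.snd))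
        (Computable.snd.comp Computable.snd)).to₂, fun x => ?_⟩
  dsimp only
  induction n x with
  | zero => simp
  | succ m ih =>
    dsimp only
    rw [Bool.or_eq_true, ih]
    constructor
    · rintro (h | ⟨i, hi, h⟩)
      · exact ⟨m, by omega, h⟩
      · exact ⟨i, by omega, h⟩
    · rintro ⟨i, hi, h⟩
      rcases (Nat.lt_succ_iff_lt_or_eq.1 hi) with h' | rfl
      · exact Or.inr ⟨i, h', h⟩
      · exact Or.inl h

end ComputableReal

/-! ### Hoeffding's inequality by counting -/

/-- The sum over all signs factors into a product of `2 * cosh (z i)`, and `cosh y ≤ exp (y ^ 2 /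
2)`. -/
theorem sum_exp_rademacher_le {N : ℕ} (z : Fin N → ℝ) :
    ∑ v : Fin N → Bool, Real.exp (∑ i, (if v i = true then 1 else -1) * z i) ≤
      2 ^ N * Real.exp ((∑ i, z i ^ 2) / 2) := by
  have h := Finset.prod_univ_sum (fun _ : Fin N => (Finset.univ : Finset Bool))
    (fun i b => Real.exp ((if b = true then 1 else -1) * z i))
  rw [Fintype.piFinset_univ] at h
  simp_rw [Real.exp_sum]
  rw [← h, Finset.sum_div, Real.exp_sum]
  have h2 : (2 : ℝ) ^ N = ∏ _i : Fin N, (2 : ℝ) := by simp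
  rw [h2, ← Finset.prod_mul_distrib]
  refine Finset.prod_le_prod (fun i _ => by positivity) fun i _ => ?_
  have := Real.cosh_le_exp_half_sq (z i)
  rw [Real.cosh_eq] at this
  simp only [Fintype.univ_bool, Finset.mem_singleton, Bool.true_eq_false, not_false_eq_true,
    Finset.sum_insert, ↓reduceIte, one_mul, Finset.sum_singleton, Bool.false_eq_true, neg_mul]
  linarith

/-- Hoeffding's inequality for Rademacher sums, in counting form. -/
theorem card_rademacher_sum_sq_gt_le {N : ℕ} (z : Fin N → ℝ) {a : ℝ} (ha : 0 ≤ a) :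
    ((Finset.univ.filter fun v : Fin N → Bool =>
      2 * a * ∑ i, z i ^ 2 < (∑ i, (if v i = true then 1 else -1) * z i) ^ 2).card : ℝ) *
        Real.exp a ≤ 2 * 2 ^ N := by
  set V := ∑ i, z i ^ 2 with hV
  set S : (Fin N → Bool) → ℝ := fun v => ∑ i, (if v i = true then 1 else -1) * z i with hS
  set F := Finset.univ.filter fun v : Fin N → Bool => 2 * a * V < S v ^ 2 with hF
  have hV0 : 0 ≤ V := Finset.sum_nonneg fun i _ => sq_nonneg _
  rcases hV0.eq_or_lt with h0 | hVpos
  -- With zero variance every sum vanishes, and the strict inequality defines the empty event.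
  · have hz : ∀ i, z i = 0 := fun i => by
      have := (Finset.sum_eq_zero_iff_of_nonneg fun i _ => sq_nonneg (z i)).1 h0.symm i
        (Finset.mem_univ i)
      exact pow_eq_zero_iff (two_ne_zero) |>.1 this
    have hFe : F = ∅ := by
      refine Finset.filter_eq_empty_iff.2 fun v _ => ?_
      simp [hS, hz, ← h0]
    rw [hFe]
    simp
  -- The optimal Chernoff parameter: `τ ^ 2 * V / 2 = a`, while `|τ * S v| ≥ 2 * a` on the event.
  -- Using both signs of `τ` gives `card * exp (2 * a) ≤ 2 * 2 ^ N * exp a`.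
  · set τ := Real.sqrt (2 * a / V) with hτ
    have hτ2 : τ ^ 2 = 2 * a / V := Real.sq_sqrt (by positivity)
    have hexp : ∀ c : ℝ, c ^ 2 = τ ^ 2 →
        ∑ v, Real.exp (c * S v) ≤ 2 ^ N * Real.exp a := by
      intro c hc
      have := sum_exp_rademacher_le fun i => c * z i
      have e1 : (∑ i, (c * z i) ^ 2) / 2 = a := by
        simp_rw [mul_pow]
        rw [← Finset.mul_sum, ← hV, hc, hτ2]
        field_simp
      rw [e1] at this
      refine le_trans (le_of_eq (Finset.sum_congr rfl fun v _ => ?_)) this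
      rw [hS, Finset.mul_sum]
      congr 1
      exact Finset.sum_congr rfl fun i _ => by ring
    have h1 : (F.card : ℝ) * Real.exp (2 * a) ≤
        ∑ v, (Real.exp (τ * S v) + Real.exp (-τ * S v)) := by
      rw [← nsmul_eq_mul, ← Finset.sum_const]
      refine (Finset.sum_le_sum fun v hv => ?_).trans
        (Finset.sum_le_sum_of_subset_of_nonneg (Finset.subset_univ F) fun v _ _ => by positivity)
      have hv' : 2 * a * V < S v ^ 2 := (Finset.mem_filter.1 hv).2
      have hsq : (2 * a) ^ 2 ≤ (τ * S v) ^ 2 := by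
        rw [mul_pow τ, hτ2, div_mul_eq_mul_div, le_div_iff₀ hVpos]
        nlinarith
      have habs : 2 * a ≤ |τ * S v| := by
        have := sq_le_sq.1 hsq
        rwa [abs_of_nonneg (a := 2 * a) (by positivity)] at this
      rcases le_abs.1 habs with h | h
      · have := Real.exp_le_exp.2 h
        linarith [Real.exp_pos (-τ * S v)]
      · have := Real.exp_le_exp.2 h
        rw [neg_mul]
        linarith [Real.exp_pos (τ * S v)]
    rw [Finset.sum_add_distrib] at h1
    have h2 := hexp τ rfl
    have h3 := hexp (-τ) (neg_sq τ)
    have h4 : Real.exp (2 * a) = Real.exp a * Real.exp a := by rw [← Real.exp_add]; ring_nf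
    rw [h4, ← mul_assoc] at h1
    refine le_of_mul_le_mul_right ?_ (Real.exp_pos a)
    linarith

/-! ### Tests on superblocks and their passing by complex strings -/

/-- The right end of the `k`-th superblock `2 ^ 2 ^ k ≤ n < 2 ^ 2 ^ (k + 1)`. -/
def blockEnd (k : ℕ) : ℕ := 2 ^ 2 ^ (k + 1)

theorem computable_blockEnd : Computable blockEnd :=
  (Computable.const 2).nat_pow ((Computable.const 2).nat_pow Computable.succ)

/-- Both quantifiers are bounded by computable functions, and comparing squares keeps the inequality
between exact rationals, with no square root. -/
theorem exists_computable_large_sum_test {z : (ℕ × ℕ) × ℕ → ℝ} (hz : IsComputableRat z) :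
    ∃ bad : ℕ → List Bool → Bool, Computable₂ bad ∧ ∀ k σ, bad k σ = true ↔
      ∃ M < blockEnd k + 1, ∃ l < 8 * blockEnd k ^ 3,
        2 * (14 * 2 ^ k) * ∑ n ∈ Finset.range M, z ((k, l), n) ^ 2 <
          (∑ n ∈ Finset.range M,
            (if σ.getD n false = true then 1 else -1) * z ((k, l), n)) ^ 2 := by
  have hk : Computable fun p : ((ℕ × List Bool) × ℕ) × ℕ => p.1.1.1 :=
    Computable.fst.comp (Computable.fst.comp Computable.fst)
  have hzf : IsComputableRat fun q : (((ℕ × List Bool) × ℕ) × ℕ) × ℕ =>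
      z ((q.1.1.1.1, q.1.2), q.2) :=
    hz.comp (((hk.comp Computable.fst).pair (Computable.snd.comp Computable.fst)).pair
      Computable.snd)
  have hM : Computable fun p : ((ℕ × List Bool) × ℕ) × ℕ => p.1.2 :=
    Computable.snd.comp Computable.fst
  have hget : Computable fun q : (((ℕ × List Bool) × ℕ) × ℕ) × ℕ =>
      q.1.1.1.2.getD q.2 false :=
    (Primrec.list_getD false).to_comp.comp
      (Computable.snd.comp (Computable.fst.comp (Computable.fst.comp Computable.fst)))
      Computable.snd
  have hone : IsComputableRat fun _ : (((ℕ × List Bool) × ℕ) × ℕ) × ℕ => (1 : ℝ) := by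
    simpa using IsComputableRat.const_natCast (α := (((ℕ × List Bool) × ℕ) × ℕ) × ℕ) 1
  have hS := ((IsComputableRat.ite hget hone IsComputableRat.const_neg_one).mul hzf).sum_range hM
  have hV := (hzf.mul hzf).sum_range hM
  have hc : IsComputableRat fun p : ((ℕ × List Bool) × ℕ) × ℕ => (2 * (14 * 2 ^ p.1.1.1) : ℝ) := by
    have h : Computable fun p : ((ℕ × List Bool) × ℕ) × ℕ => 2 * (14 * 2 ^ p.1.1.1) :=
      Primrec.nat_mul.to_comp.comp (Computable.const 2) (Primrec.nat_mul.to_comp.comp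
        (Computable.const 14) ((Computable.const 2).nat_pow hk))
    simpa using IsComputableRat.natCast h
  obtain ⟨c, hcc, hc⟩ := (hc.mul hV).lt (hS.mul hS)
  have hl : Computable fun p : (ℕ × List Bool) × ℕ => 8 * blockEnd p.1.1 ^ 3 :=
    Primrec.nat_mul.to_comp.comp (Computable.const 8) (Computable.nat_pow
      (computable_blockEnd.comp (Computable.fst.comp Computable.fst)) (Computable.const 3))
  obtain ⟨c₁, hc₁c, hc₁⟩ := Computable.exists_lt (p := fun q l => c (q, l)) hcc.to₂ hl
  obtain ⟨c₂, hc₂c, hc₂⟩ := Computable.exists_lt (p := fun q M => c₁ (q, M)) hc₁c.to₂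
    (Computable.succ.comp (computable_blockEnd.comp
      (Computable.fst (α := ℕ) (β := List Bool))))
  refine ⟨fun k σ => c₂ (k, σ), hc₂c.to₂, fun k σ => ?_⟩
  rw [hc₂]
  simp only [hc₁, hc, Nat.succ_eq_add_one, pow_two]

theorem sum_range_eq_sum_fin {M N : ℕ} (h : M ≤ N) (f : ℕ → ℝ) :
    ∑ n ∈ Finset.range M, f n = ∑ i : Fin N, if (i : ℕ) < M then f i else 0 := by
  rw [Fin.sum_univ_eq_sum_range (fun n => if n < M then f n else 0) N, ← Finset.sum_filter]
  congr 1
  ext n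
  simp only [Finset.mem_range, Finset.mem_filter]
  omega

/-- Coefficients from `M` on are set to zero, which reduces to sums of full length. A union over `M`
then replaces a maximal inequality. -/
theorem card_partial_sum_sq_gt_le {M N : ℕ} (h : M ≤ N) (z : ℕ → ℝ) {a : ℝ} (ha : 0 ≤ a) :
    ((Finset.univ.filter fun v : Fin N → Bool =>
      2 * a * ∑ n ∈ Finset.range M, z n ^ 2 <
        (∑ n ∈ Finset.range M,
          (if (List.ofFn v).getD n false = true then 1 else -1) * z n) ^ 2).card : ℝ) *
        Real.exp a ≤ 2 * 2 ^ N := by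
  refine le_trans (le_of_eq ?_)
    (card_rademacher_sum_sq_gt_le (fun i : Fin N => if (i : ℕ) < M then z i else 0) ha)
  congr 4
  ext v
  rw [sum_range_eq_sum_fin h, sum_range_eq_sum_fin h]
  have e1 : ∀ i : Fin N, (if (i : ℕ) < M then z i ^ 2 else 0) =
      (if (i : ℕ) < M then z i else 0) ^ 2 := fun i => by split_ifs <;> simp
  have e2 : ∀ i : Fin N, (if (i : ℕ) < M then
      (if (List.ofFn v).getD i false = true then 1 else -1) * z i else 0) =
      (if v i = true then 1 else -1) * (if (i : ℕ) < M then z i else 0) := fun i => by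
    have : (List.ofFn v).getD i false = v i := by
      simp [List.getD_eq_getElem?_getD]
    rw [this]
    split_ifs <;> simp
  simp only [e1, e2]

theorem two_pow_le_blockEnd (k : ℕ) : 2 ^ k ≤ blockEnd k :=
  Nat.pow_le_pow_right (by norm_num) ((Nat.lt_two_pow_self).le.trans
    (Nat.pow_le_pow_right (by norm_num) (by omega)))

theorem IsKolmogorovChaitinComplex.eventually_rademacher_sum_sq_le {α : ℕ → Bool}
    (hα : IsKolmogorovChaitinComplex α) {z : (ℕ × ℕ) × ℕ → ℝ} (hz : IsComputableRat z) :
    ∀ᶠ k in atTop, ∀ M ≤ blockEnd k, ∀ l < 8 * blockEnd k ^ 3,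
      (∑ n ∈ Finset.range M, (if α n = true then 1 else -1) * z ((k, l), n)) ^ 2 ≤
        28 * 2 ^ k * ∑ n ∈ Finset.range M, z ((k, l), n) ^ 2 := by
  obtain ⟨bad, hbadc, hbad⟩ := exists_computable_large_sum_test hz
  have hL : Computable fun k => blockEnd k - 2 ^ k :=
    Primrec.nat_sub.to_comp.comp computable_blockEnd
      ((Computable.const 2).nat_pow Computable.id)
  have hcard : ∀ k, (Finset.univ.filter fun v : Fin (blockEnd k) → Bool =>
      bad k (List.ofFn v) = true).card ≤ 2 ^ (blockEnd k - 2 ^ k) := by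
    intro k
    set N := blockEnd k with hN
    set q := 2 ^ k with hq
    set E : ℕ → ℕ → Finset (Fin N → Bool) := fun M l => Finset.univ.filter fun v =>
      2 * (14 * 2 ^ k) * ∑ n ∈ Finset.range M, z ((k, l), n) ^ 2 <
        (∑ n ∈ Finset.range M,
          (if (List.ofFn v).getD n false = true then 1 else -1) * z ((k, l), n)) ^ 2 with hE
    have hsub : (Finset.univ.filter fun v : Fin N → Bool => bad k (List.ofFn v) = true) ⊆
        (Finset.range (N + 1)).biUnion fun M => (Finset.range (8 * N ^ 3)).biUnion fun l =>
          E M l := by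
      intro v hv
      obtain ⟨M, hM, l, hl, h⟩ := (hbad _ _).1 (Finset.mem_filter.1 hv).2
      exact Finset.mem_biUnion.2 ⟨M, Finset.mem_range.2 hM, Finset.mem_biUnion.2
        ⟨l, Finset.mem_range.2 hl, Finset.mem_filter.2 ⟨Finset.mem_univ _, h⟩⟩⟩
    have hexp : (2 : ℝ) ^ (14 * q) ≤ Real.exp (14 * 2 ^ k) := by
      have h1 : (2 : ℝ) ≤ Real.exp 1 := by linarith [Real.add_one_le_exp (1 : ℝ)]
      calc (2 : ℝ) ^ (14 * q) ≤ Real.exp 1 ^ (14 * q) := by gcongr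
        _ = Real.exp (14 * 2 ^ k) := by rw [← Real.exp_nat_mul]; push_cast [hq]; ring_nf
    have hEcard : ∀ M ∈ Finset.range (N + 1), ∀ l,
        (E M l).card * 2 ^ (14 * q) ≤ 2 * 2 ^ N := by
      intro M hM l
      have h := card_partial_sum_sq_gt_le (N := N) (Nat.lt_succ_iff.1 (Finset.mem_range.1 hM))
        (fun n => z ((k, l), n)) (a := 14 * 2 ^ k) (by positivity)
      have h2 : ((E M l).card : ℝ) * 2 ^ (14 * q) ≤ 2 * 2 ^ N :=
        (mul_le_mul_of_nonneg_left hexp (Nat.cast_nonneg _)).trans h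
      exact_mod_cast h2
    have hsum : (Finset.univ.filter fun v : Fin N → Bool => bad k (List.ofFn v) = true).card *
        2 ^ (14 * q) ≤ (N + 1) * (8 * N ^ 3 * (2 * 2 ^ N)) := by
      refine (Nat.mul_le_mul_right _ ((Finset.card_le_card hsub).trans
        (Finset.card_biUnion_le.trans (Finset.sum_le_sum fun M _ =>
          Finset.card_biUnion_le)))).trans ?_
      rw [Finset.sum_mul]
      refine (Finset.sum_le_card_nsmul _ _ (8 * N ^ 3 * (2 * 2 ^ N)) fun M hM => ?_).trans
        (by simp)
      rw [Finset.sum_mul]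
      exact (Finset.sum_le_card_nsmul _ _ (2 * 2 ^ N) fun l _ => hEcard M hM l).trans (by simp)
    have hq1 : 1 ≤ q := Nat.one_le_two_pow
    have hqN : q ≤ N := two_pow_le_blockEnd k
    have hNq : N = 2 ^ (2 * q) := by rw [hN, blockEnd, hq, pow_succ']
    -- With `q = 2 ^ k` and `N = 2 ^ (2 * q)`, the union bound costs at most `2 ^ 5 * N ^ 4 ≤ 2 ^
    -- (13 * q)`. The gain `2 ^ (14 * q)` from Hoeffding leaves a net saving of `q` bits.
    have hbound : (N + 1) * (8 * N ^ 3 * (2 * 2 ^ N)) ≤ 2 ^ (13 * q) * 2 ^ N := by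
      have h4 : N ^ 4 = 2 ^ (8 * q) := by rw [hNq, ← pow_mul]; ring_nf
      calc (N + 1) * (8 * N ^ 3 * (2 * 2 ^ N)) ≤ (2 * N) * (8 * N ^ 3 * (2 * 2 ^ N)) := by
            gcongr; omega
        _ = 2 ^ 5 * N ^ 4 * 2 ^ N := by ring
        _ ≤ 2 ^ (5 * q) * 2 ^ (8 * q) * 2 ^ N := by
            rw [h4]
            gcongr
            · norm_num
            · omega
        _ = 2 ^ (13 * q) * 2 ^ N := by rw [← pow_add]; ring_nf
    have hfin := hsum.trans hbound
    have e1 : 2 ^ N = 2 ^ (N - q) * 2 ^ q := by rw [← pow_add]; congr 1; omega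
    have e2 : 2 ^ (14 * q) = 2 ^ (13 * q) * 2 ^ q := by rw [← pow_add]; ring_nf
    rw [e1, e2] at hfin
    refine Nat.le_of_mul_le_mul_right (c := 2 ^ (13 * q) * 2 ^ q) ?_ (by positivity)
    calc _ ≤ _ := hfin
      _ = _ := by ring
  -- The saving `2 ^ k` outgrows the cost `k` of the unary block number plus any constant.
  have hgap : ∀ d : ℕ, ∀ᶠ k : ℕ in atTop, k + (blockEnd k - 2 ^ k) + d < blockEnd k := by
    intro d
    filter_upwards [eventually_ge_atTop (d + 2)] with k hk
    have h1 := two_pow_le_blockEnd k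
    have h2 : 2 * k ≤ 2 ^ k := by
      have := Nat.lt_two_pow_self (n := k - 1)
      have e : 2 ^ k = 2 * 2 ^ (k - 1) := by rw [← pow_succ']; congr 1; omega
      omega
    omega
  filter_upwards [hα.eventually_passes computable_blockEnd hL hbadc hcard hgap] with k hk
  intro M hM l hl
  by_contra hcon
  rw [not_le] at hcon
  have : bad k ((List.range (blockEnd k)).map α) = true := by
    refine (hbad _ _).2 ⟨M, Nat.lt_succ_of_le hM, l, hl, ?_⟩
    have e : ∑ n ∈ Finset.range M, (if ((List.range (blockEnd k)).map α).getD n false = true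
        then 1 else -1) * z ((k, l), n) =
        ∑ n ∈ Finset.range M, (if α n = true then 1 else -1) * z ((k, l), n) := by
      refine Finset.sum_congr rfl fun n hn => ?_
      have hn' : n < blockEnd k := (Finset.mem_range.1 hn).trans_le hM
      simp [List.getD_eq_getElem?_getD, hn']
    rw [e]
    refine lt_of_eq_of_lt ?_ hcon
    ring
  rw [hk] at this
  exact Bool.false_ne_true this

/-- Vanishing below the superblock lets the tests sum from `0`. The factor `2 ^ (-n)` in the
tolerance makes the total error over a superblock bounded, and `2 ^ (-2 * k)` makes it summable in
`k`, also after multiplication by `2 ^ k`. -/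
theorem exists_computableRat_approx {x φ : ℕ → ℝ} (hx : IsComputableRealSeq x)
    (hφ : IsComputableRealSeq φ) :
    ∃ z : (ℕ × ℕ) × ℕ → ℝ, IsComputableRat z ∧ ∀ k l n,
      (n < 2 ^ 2 ^ k → z ((k, l), n) = 0) ∧
      (2 ^ 2 ^ k ≤ n → |x n * Real.cos (n * (l * ((blockEnd k : ℝ) ^ 3)⁻¹) + φ n) -
        z ((k, l), n)| ≤ (1 / 2 : ℝ) ^ (n + 2 * k)) := by
  have hk : Computable fun p : (ℕ × ℕ) × ℕ => p.1.1 := Computable.fst.comp Computable.fst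
  have hl : Computable fun p : (ℕ × ℕ) × ℕ => p.1.2 := Computable.snd.comp Computable.fst
  have hn : Computable fun p : (ℕ × ℕ) × ℕ => p.2 := Computable.snd
  have hinv : IsComputableRat fun p : (ℕ × ℕ) × ℕ => ((blockEnd p.1.1 : ℝ) ^ 3)⁻¹ := by
    simpa using IsComputableRat.inv_natCast
      ((computable_blockEnd.comp hk).nat_pow (Computable.const 3))
  have harg := (IsComputableRat.natCast hn).mul ((IsComputableRat.natCast hl).mul hinv)
  have hf := (hx.isComputableReal.comp hn).mul_of_abs_le_one
    (harg.isComputableReal.add (hφ.isComputableReal.comp hn)).cos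
    (fun _ => Real.abs_cos_le_one _)
  obtain ⟨r, hr, hfr⟩ := hf
  have hm : Computable fun p : (ℕ × ℕ) × ℕ => (p, p.2 + 2 * p.1.1) :=
    Computable.id.pair (Primrec.nat_add.to_comp.comp hn
      (Primrec.nat_mul.to_comp.comp (Computable.const 2) hk))
  have hle : Computable fun p : (ℕ × ℕ) × ℕ => decide (2 ^ 2 ^ p.1.1 ≤ p.2) :=
    (PrimrecRel.decide Primrec.nat_le).to_comp.comp
      ((Computable.const 2).nat_pow ((Computable.const 2).nat_pow hk)) hn
  have h0 : IsComputableRat fun _ : (ℕ × ℕ) × ℕ => (0 : ℝ) := by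
    simpa using IsComputableRat.const_natCast (α := (ℕ × ℕ) × ℕ) 0
  refine ⟨_, IsComputableRat.ite hle (hr.comp hm) h0, fun k l n => ⟨fun h => ?_, fun h => ?_⟩⟩
  · simp [h]
  · simpa [h] using hfr ((k, l), n) (n + 2 * k)

/-! ### Deterministic estimates on a superblock -/

theorem dyadicBlockNorm_nonneg (x : ℕ → ℝ) (j : ℕ) : 0 ≤ dyadicBlockNorm x j :=
  Real.sqrt_nonneg _

theorem sq_dyadicBlockNorm (x : ℕ → ℝ) (j : ℕ) :
    dyadicBlockNorm x j ^ 2 = ∑ n ∈ Finset.Ico (2 ^ j) (2 ^ (j + 1)), x n ^ 2 :=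
  Real.sq_sqrt (Finset.sum_nonneg fun _ _ => sq_nonneg _)

theorem sum_Ico_two_pow_sq (x : ℕ → ℝ) {p q : ℕ} (h : p ≤ q) :
    ∑ n ∈ Finset.Ico (2 ^ p) (2 ^ q), x n ^ 2 =
      ∑ j ∈ Finset.Ico p q, dyadicBlockNorm x j ^ 2 := by
  induction q, h using Nat.le_induction with
  | base => simp
  | succ q h ih =>
    rw [Finset.sum_Ico_succ_top h, ← ih, sq_dyadicBlockNorm,
      Finset.sum_Ico_consecutive _ (Nat.pow_le_pow_right (by norm_num) h)
        (Nat.pow_le_pow_right (by norm_num) q.le_succ)]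

theorem sum_superblock_sq_le {x : ℕ → ℝ} (hanti : Antitone (dyadicBlockNorm x)) (k : ℕ) :
    ∑ n ∈ Finset.Ico (2 ^ 2 ^ k) (blockEnd k), x n ^ 2 ≤
      2 ^ k * dyadicBlockNorm x (2 ^ k) ^ 2 := by
  rw [blockEnd, sum_Ico_two_pow_sq x (Nat.pow_le_pow_right (by norm_num) k.le_succ)]
  refine (Finset.sum_le_card_nsmul _ _ (dyadicBlockNorm x (2 ^ k) ^ 2) fun j hj =>
    pow_le_pow_left₀ (dyadicBlockNorm_nonneg x j) (hanti (Finset.mem_Ico.1 hj).1) 2).trans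
    (le_of_eq ?_)
  rw [Nat.card_Ico, nsmul_eq_mul, show 2 ^ (k + 1) - 2 ^ k = 2 ^ k by rw [pow_succ]; omega]
  push_cast
  rfl

/-- A uniform bound on the coefficients, needed to control the error of moving `t` to a grid point.
-/
theorem abs_le_dyadicBlockNorm_zero {x : ℕ → ℝ} (hanti : Antitone (dyadicBlockNorm x)) {n : ℕ}
    (hn : n ≠ 0) : |x n| ≤ dyadicBlockNorm x 0 := by
  refine le_trans ?_ (hanti (Nat.zero_le (Nat.log 2 n)))
  refine Real.le_sqrt_of_sq_le ?_
  rw [sq_abs]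
  exact Finset.single_le_sum (f := fun n => x n ^ 2) (fun _ _ => sq_nonneg _)
    (Finset.mem_Ico.2 ⟨Nat.pow_log_le_self 2 hn, Nat.lt_pow_succ_log_self (by norm_num) n⟩)

theorem sum_Ico_half_pow_le (a b : ℕ) : ∑ n ∈ Finset.Ico a b, (1 / 2 : ℝ) ^ n ≤ 2 := by
  refine le_trans (Summable.sum_le_tsum _ (fun n _ => by positivity)
    summable_geometric_two) (le_of_eq tsum_geometric_two)

/-- Periodicity reduces `2πt` to `θ < 2π < 8`, `θ` is rounded down to a multiple of `1 / D`, and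
`cos` is 1-Lipschitz. One grid point serves all frequencies and phases. -/
theorem exists_grid_point (D : ℕ) (hD : 0 < D) (t : ℝ) :
    ∃ l < 8 * D, ∀ (n : ℕ) (c : ℝ),
      |Real.cos (2 * Real.pi * n * t + c) - Real.cos (n * (l * (D : ℝ)⁻¹) + c)| ≤
        n * (D : ℝ)⁻¹ := by
  have hD' : (0 : ℝ) < D := by exact_mod_cast hD
  set θ := 2 * Real.pi * Int.fract t with hθ
  have hπ := Real.pi_pos
  have hπ2 := Real.pi_lt_d2
  have hf0 := Int.fract_nonneg t
  have hf1 := Int.fract_lt_one t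
  have hθ0 : 0 ≤ θ := by positivity
  have hθ8 : θ < 8 := by nlinarith
  refine ⟨⌊θ * D⌋₊, ?_, fun n c => ?_⟩
  · rw [Nat.floor_lt (by positivity)]
    push_cast
    gcongr
  · have e : Real.cos (2 * Real.pi * n * t + c) = Real.cos (n * θ + c) := by
      rw [← Real.cos_add_int_mul_two_pi (n * θ + c) (n * ⌊t⌋)]
      congr 1
      push_cast
      rw [hθ]
      nth_rewrite 1 [← Int.floor_add_fract t]
      ring
    rw [e]
    refine (Real.abs_cos_sub_cos_le _ _).trans ?_
    rw [add_sub_add_right_eq_sub, ← mul_sub, abs_mul, Nat.abs_cast]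
    gcongr
    have h1 := Nat.floor_le (a := θ * D) (by positivity)
    have h2 := Nat.lt_floor_add_one (θ * D)
    rw [← div_eq_mul_inv, ← one_div, abs_of_nonneg
      (sub_nonneg.2 ((div_le_iff₀ hD').2 h1)), sub_le_iff_le_add, ← add_div, le_div_iff₀ hD']
    linarith

/-- The trigonometric sums over the initial parts of a superblock are small, if the sums at the
points of a grid and with approximate coefficients are. -/
theorem abs_sum_superblock_le {x φ ε : ℕ → ℝ} (hε : ∀ n, |ε n| = 1)
    (hanti : Antitone (dyadicBlockNorm x)) {k M : ℕ} (hM : M ≤ blockEnd k)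
    {z : (ℕ × ℕ) × ℕ → ℝ}
    (hz : ∀ l n, (n < 2 ^ 2 ^ k → z ((k, l), n) = 0) ∧
      (2 ^ 2 ^ k ≤ n → |x n * Real.cos (n * (l * ((blockEnd k : ℝ) ^ 3)⁻¹) + φ n) -
        z ((k, l), n)| ≤ (1 / 2 : ℝ) ^ (n + 2 * k)))
    (hS : ∀ l < 8 * blockEnd k ^ 3, (∑ n ∈ Finset.range M, ε n * z ((k, l), n)) ^ 2 ≤
        28 * 2 ^ k * ∑ n ∈ Finset.range M, z ((k, l), n) ^ 2) (t : ℝ) :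
    |∑ n ∈ Finset.Ico (2 ^ 2 ^ k) M, ε n * x n * Real.cos (2 * Real.pi * n * t + φ n)| ≤
      8 * (2 ^ k * dyadicBlockNorm x (2 ^ k)) + (14 + dyadicBlockNorm x 0) * (1 / 2 : ℝ) ^ k := by
  set N := blockEnd k with hN
  have hN0 : 0 < N := Nat.pow_pos (by norm_num)
  have hN0' : (0 : ℝ) < N := by exact_mod_cast hN0
  obtain ⟨l, hl, hgrid⟩ := exists_grid_point (N ^ 3) (Nat.pow_pos hN0) t
  push_cast at hgrid
  set δ : ℝ := (1 / 2) ^ k with hδ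
  set s := dyadicBlockNorm x (2 ^ k)
  set X := dyadicBlockNorm x 0
  set A := 2 ^ 2 ^ k with hA
  set I := Finset.Ico A M with hI
  have hδ0 : 0 < δ := by positivity
  have hδ1 : δ ≤ 1 := pow_le_one₀ (by norm_num) (by norm_num)
  have hkδ : (2 : ℝ) ^ k * δ = 1 := by rw [hδ, ← mul_pow]; norm_num
  have hs0 : 0 ≤ s := dyadicBlockNorm_nonneg _ _
  have hX0 : 0 ≤ X := dyadicBlockNorm_nonneg _ _
  have hpow : ∀ n, (1 / 2 : ℝ) ^ (n + 2 * k) = (1 / 2) ^ n * δ ^ 2 := fun n => by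
    rw [pow_add, hδ, ← pow_mul, mul_comm k]
  have hNδ : (N : ℝ)⁻¹ ≤ δ := by
    rw [hδ, one_div, inv_pow]
    exact inv_anti₀ (by positivity) (by exact_mod_cast two_pow_le_blockEnd k)
  set y : ℕ → ℝ := fun n => z ((k, l), n) with hy
  have hzero : ∀ n ∈ Finset.range M, n ∉ I → y n = 0 := fun n hn hnI => by
    refine (hz l n).1 ?_
    by_contra h
    exact hnI (Finset.mem_Ico.2 ⟨not_lt.1 h, Finset.mem_range.1 hn⟩)
  have hIsub : I ⊆ Finset.range M := fun n hn =>
    Finset.mem_range.2 (Finset.mem_Ico.1 hn).2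
  have hS' := hS l hl
  rw [← Finset.sum_subset hIsub (fun n hn hnI => by
      rw [show z ((k, l), n) = 0 from hzero n hn hnI, mul_zero]),
    ← Finset.sum_subset hIsub (fun n hn hnI => by
      rw [show z ((k, l), n) = 0 from hzero n hn hnI]; norm_num)] at hS'
  have hX : ∀ n ∈ I, |x n| ≤ X := fun n hn => abs_le_dyadicBlockNorm_zero hanti (by
    have h1 := (Finset.mem_Ico.1 hn).1
    have h2 : 0 < A := Nat.pow_pos (by norm_num)
    omega)
  have happ : ∀ n ∈ I, |x n * Real.cos (n * (l * ((N : ℝ) ^ 3)⁻¹) + φ n) - y n| ≤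
      (1 / 2) ^ n * δ ^ 2 := fun n hn => by
    rw [← hpow]
    exact (hz l n).2 (Finset.mem_Ico.1 hn).1
  have hterm : ∀ n ∈ I, |x n * Real.cos (2 * Real.pi * n * t + φ n) - y n| ≤
      X * ((N : ℝ) ^ 2)⁻¹ + (1 / 2) ^ n * δ ^ 2 := fun n hn => by
    refine (abs_sub_le _ (x n * Real.cos (n * (l * ((N : ℝ) ^ 3)⁻¹) + φ n)) _).trans
      (add_le_add ?_ (happ n hn))
    rw [← mul_sub, abs_mul]
    refine mul_le_mul (hX n hn) ((hgrid n (φ n)).trans ?_) (abs_nonneg _) hX0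
    have hnN : (n : ℝ) ≤ N := by
      exact_mod_cast (Finset.mem_Ico.1 hn).2.le.trans hM
    calc (n : ℝ) * ((N : ℝ) ^ 3)⁻¹ ≤ N * ((N : ℝ) ^ 3)⁻¹ := by gcongr
      _ = ((N : ℝ) ^ 2)⁻¹ := by field_simp
  have hcard : (I.card : ℝ) ≤ N := by
    rw [hI, Nat.card_Ico]
    exact_mod_cast (Nat.sub_le _ _).trans hM
  have hdiff : |∑ n ∈ I, ε n * x n * Real.cos (2 * Real.pi * n * t + φ n) -
      ∑ n ∈ I, ε n * y n| ≤ (X + 2) * δ := by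
    rw [← Finset.sum_sub_distrib]
    refine (Finset.abs_sum_le_sum_abs _ _).trans ?_
    have h1 : ∀ n ∈ I, |ε n * x n * Real.cos (2 * Real.pi * n * t + φ n) - ε n * y n| ≤
        X * ((N : ℝ) ^ 2)⁻¹ + (1 / 2) ^ n * δ ^ 2 := fun n hn => by
      rw [mul_assoc, ← mul_sub, abs_mul, hε, one_mul]
      exact hterm n hn
    refine (Finset.sum_le_sum h1).trans ?_
    rw [Finset.sum_add_distrib, Finset.sum_const, nsmul_eq_mul, ← Finset.sum_mul, add_mul]
    -- Grid spacing `N ^ (-3)` loses one power of `N` to the frequency and one to the number of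
    -- terms; the remaining `N⁻¹` is at most `δ`.
    have h2 : (I.card : ℝ) * (X * ((N : ℝ) ^ 2)⁻¹) ≤ X * δ := by
      calc (I.card : ℝ) * (X * ((N : ℝ) ^ 2)⁻¹) ≤ N * (X * ((N : ℝ) ^ 2)⁻¹) := by gcongr
        _ = X * (N : ℝ)⁻¹ := by field_simp
        _ ≤ X * δ := by gcongr
    have h3 : (∑ n ∈ I, (1 / 2 : ℝ) ^ n) * δ ^ 2 ≤ 2 * δ := by
      have := sum_Ico_half_pow_le A M
      have h4 : δ ^ 2 ≤ δ := by nlinarith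
      exact mul_le_mul this h4 (by positivity) (by norm_num)
    exact add_le_add h2 h3
  have hysq : ∑ n ∈ I, y n ^ 2 ≤ 2 * (2 ^ k * s ^ 2) + 4 * δ ^ 4 := by
    have h1 : ∀ n ∈ I, y n ^ 2 ≤ 2 * x n ^ 2 + 2 * ((1 / 2) ^ n * δ ^ 4) := fun n hn => by
      set c := Real.cos (n * (l * ((N : ℝ) ^ 3)⁻¹) + φ n)
      have hc : c ^ 2 ≤ 1 := Real.cos_sq_le_one _
      set d := x n * c - y n with hd
      have hd2 : d ^ 2 ≤ (1 / 2) ^ n * δ ^ 4 := by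
        have h0 : (1 / 2 : ℝ) ^ n ≤ 1 := pow_le_one₀ (by norm_num) (by norm_num)
        have h0' : (0 : ℝ) < (1 / 2 : ℝ) ^ n := by positivity
        calc d ^ 2 = |d| ^ 2 := (sq_abs _).symm
          _ ≤ ((1 / 2) ^ n * δ ^ 2) ^ 2 := by
            gcongr
            exact happ n hn
          _ = ((1 / 2) ^ n * δ ^ 4) * (1 / 2) ^ n := by ring
          _ ≤ ((1 / 2) ^ n * δ ^ 4) * 1 := by gcongr
          _ = _ := mul_one _
      have e : y n = x n * c - d := by rw [hd]; ring
      have hxc : (x n * c) ^ 2 ≤ x n ^ 2 := by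
        rw [mul_pow]
        exact mul_le_of_le_one_right (sq_nonneg _) hc
      rw [e]
      nlinarith [sq_nonneg (x n * c + d)]
    refine (Finset.sum_le_sum h1).trans ?_
    rw [Finset.sum_add_distrib, ← Finset.mul_sum, ← Finset.mul_sum, ← Finset.sum_mul]
    have h2 : ∑ n ∈ I, x n ^ 2 ≤ 2 ^ k * s ^ 2 :=
      (Finset.sum_le_sum_of_subset_of_nonneg (Finset.Ico_subset_Ico_right hM)
        fun _ _ _ => sq_nonneg _).trans (sum_superblock_sq_le hanti k)
    have h3 := mul_le_mul_of_nonneg_right (sum_Ico_half_pow_le A M) (by positivity : 0 ≤ δ ^ 4)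
    linarith
  -- The square of the sum is at most `56 * (2 ^ k * s) ^ 2 + 112 * δ ^ 3`, and `56 ≤ 8 ^ 2`, `112 ≤
  -- 12 ^ 2`, `δ ≤ 1`.
  have hmain : |∑ n ∈ I, ε n * y n| ≤ 8 * (2 ^ k * s) + 12 * δ := by
    refine abs_le_of_sq_le_sq ?_ (by positivity)
    refine hS'.trans ((mul_le_mul_of_nonneg_left hysq (by positivity)).trans ?_)
    have e1 : 28 * 2 ^ k * (2 * (2 ^ k * s ^ 2) + 4 * δ ^ 4) =
        56 * (2 ^ k * s) ^ 2 + 112 * (2 ^ k * δ) * δ ^ 3 := by ring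
    have h4 : δ ^ 3 ≤ δ ^ 2 := pow_le_pow_of_le_one hδ0.le hδ1 (by norm_num)
    rw [e1, hkδ]
    have h5 : 0 ≤ 2 ^ k * s := by positivity
    nlinarith [mul_nonneg h5 hδ0.le, sq_nonneg (2 ^ k * s), sq_nonneg δ]
  have := abs_sub_abs_le_abs_sub
    (∑ n ∈ I, ε n * x n * Real.cos (2 * Real.pi * n * t + φ n)) (∑ n ∈ I, ε n * y n)
  linarith

/-! ### From block estimates to uniform convergence -/

/-- A sequence of functions whose oscillation over consecutive blocks of indices is bounded by a
summable sequence converges uniformly. -/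
theorem exists_tendstoUniformly_of_block_bound {F : ℕ → ℝ → ℝ} {a : ℕ → ℕ} (ha : StrictMono a)
    {R : ℕ → ℝ} (hR0 : ∀ k, 0 ≤ R k) (hR : Summable R)
    (h : ∀ᶠ k in atTop, ∀ M, a k ≤ M → M ≤ a (k + 1) → ∀ t, |F M t - F (a k) t| ≤ R k) :
    ∃ f, TendstoUniformly F f atTop := by
  obtain ⟨K₀, hK₀⟩ := eventually_atTop.1 h
  have hends : ∀ K ≥ K₀, ∀ k ≥ K, ∀ t, |F (a k) t - F (a K) t| ≤ ∑ j ∈ Finset.Ico K k, R j := by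
    intro K hK k hk t
    induction k, hk using Nat.le_induction with
    | base => simp
    | succ k hk ih =>
      rw [Finset.sum_Ico_succ_top hk]
      have := hK₀ k (hK.trans hk) (a (k + 1)) (ha k.lt_succ_self).le le_rfl t
      linarith [abs_sub_le (F (a (k + 1)) t) (F (a k) t) (F (a K) t)]
  have htail : ∀ K ≥ K₀, ∀ m ≥ a K, ∀ t, |F m t - F (a K) t| ≤ ∑' j, R (j + K) := by
    intro K hK m hm t
    -- The block containing `m`; searching up to `m` is enough because a strictly increasing `a`
    -- satisfies `k ≤ a k`.
    set k := Nat.findGreatest (fun k => a k ≤ m) m with hk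
    have hKm : K ≤ m := (ha.le_apply).trans hm
    have hKk : K ≤ k := Nat.le_findGreatest hKm hm
    have hkm : a k ≤ m := Nat.findGreatest_spec (P := fun k => a k ≤ m) hKm hm
    have hmk : m ≤ a (k + 1) := by
      by_contra hcon
      rw [not_le] at hcon
      have h1 : k + 1 ≤ m := (ha.le_apply).trans hcon.le
      have := Nat.le_findGreatest (P := fun k => a k ≤ m) h1 hcon.le
      omega
    have h1 := hK₀ k (hK.trans hKk) m hkm hmk t
    have h2 := hends K hK k hKk t
    have h3 : ∑ j ∈ Finset.Ico K (k + 1), R j ≤ ∑' j, R (j + K) := by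
      rw [Finset.sum_Ico_eq_sum_range]
      simp_rw [add_comm K]
      exact Summable.sum_le_tsum _ (fun _ _ => hR0 _) ((summable_nat_add_iff K).2 hR)
    rw [Finset.sum_Ico_succ_top hKk] at h3
    linarith [abs_sub_le (F m t) (F (a k) t) (F (a K) t)]
  have hcauchy : UniformCauchySeqOn F atTop Set.univ := by
    rw [Metric.uniformCauchySeqOn_iff]
    intro e he
    have hlim := tendsto_sum_nat_add R
    obtain ⟨K, hKe, hK⟩ := ((hlim.eventually (gt_mem_nhds (half_pos he))).and
      (eventually_ge_atTop K₀)).exists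
    refine ⟨a K, fun m hm n hn t _ => ?_⟩
    have h1 := htail K hK m hm t
    have h2 := htail K hK n hn t
    rw [abs_sub_comm] at h2
    rw [Real.dist_eq]
    linarith [abs_sub_le (F m t) (F (a K) t) (F n t)]
  have hpt : ∀ t, ∃ y, Tendsto (fun n => F n t) atTop (𝓝 y) := fun t =>
    cauchySeq_tendsto_of_complete (hcauchy.cauchySeq (Set.mem_univ t))
  choose f hf using hpt
  exact ⟨f, tendstoUniformlyOn_univ.1 (hcauchy.tendstoUniformlyOn_of_tendsto fun t _ => hf t)⟩

theorem mainTheorem3 (x φ ε : ℕ → ℝ)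
    (hx : IsComputableRealSeq x) (hφ : IsComputableRealSeq φ)
    (hε : IsAlgorithmicallyRandomRademacher ε)
    (hanti : Antitone (dyadicBlockNorm x)) (hsum : Summable (dyadicBlockNorm x)) :
    ∃ f : ℝ → ℝ, Continuous f ∧
      TendstoUniformly
        (fun (N : ℕ) (t : ℝ) =>
          ∑ n ∈ Finset.range N, ε n * x n * Real.cos (2 * Real.pi * (n : ℝ) * t + φ n))
        f atTop := by
  obtain ⟨α, hα, hεα⟩ := hε
  obtain ⟨z, hzc, hz⟩ := exists_computableRat_approx hx hφ
  have hε1 : ∀ n, |ε n| = 1 := fun n => by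
    rw [hεα]
    split_ifs <;> simp
  -- Cauchy condensation: for the decreasing sequence `s`, summability of `s_j` is equivalent to
  -- that of `2 ^ k * s_{2^k}`.
  have hR : Summable fun k => 8 * (2 ^ k * dyadicBlockNorm x (2 ^ k)) +
      (14 + dyadicBlockNorm x 0) * (1 / 2 : ℝ) ^ k :=
    (((summable_condensed_iff_of_nonneg (dyadicBlockNorm_nonneg x)
      (fun _ _ _ h => hanti h)).2 hsum).mul_left 8).add (summable_geometric_two.mul_left _)
  have hstrict : StrictMono fun k : ℕ => 2 ^ 2 ^ k :=
    fun _ _ h => Nat.pow_lt_pow_right one_lt_two (Nat.pow_lt_pow_right one_lt_two h)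
  obtain ⟨f, hf⟩ := exists_tendstoUniformly_of_block_bound
    (F := fun (N : ℕ) (t : ℝ) =>
      ∑ n ∈ Finset.range N, ε n * x n * Real.cos (2 * Real.pi * (n : ℝ) * t + φ n))
    hstrict (fun k => by
      have := dyadicBlockNorm_nonneg x
      have h1 := this 0
      have h2 := this (2 ^ k)
      positivity) hR (by
    filter_upwards [hα.eventually_rademacher_sum_sq_le hzc] with k hk
    intro M hAM hM t
    rw [← Finset.sum_Ico_eq_sub _ hAM]
    refine abs_sum_superblock_le hε1 hanti hM (hz k) (fun l hl => ?_) t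
    simp only [hεα]
    exact hk M hM l hl)
  refine ⟨f, hf.continuous (Frequently.of_forall fun N => ?_), hf⟩
  fun_prop
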